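/- Let $X$ be a Polish space with a compatible metric, let $\mathcal M(X)$ be the set of measures on $X$ that are finite on bounded Borel sets, and let $\mathcal M^{\cdot\cdot}(X)\subset\mathcal M(X)$ be the set of those taking integer values on bounded Borel sets (configurations of points with multiplicities), both with the $\sigma$-algebra generated by the evaluations $\kappa\mapsto\kappa(A)$, $A$ bounded Borel. Let $z\in(0,1)$ and $\rho\in\mathcal M(X)$. For $\kappa\in\mathcal M(X)$ let $\mathrm{Poi}_\kappa$ be the law on $\mathcal M^{\cdot\cdot}(X)$ of the Poisson process with intensity measure $\kappa$. For $w\in(0,1)$ and $\sigma\in\mathcal M(X)$ let $\mathrm{GP}_{w,\sigma}$ be the Poisson–Gamma random measure, i.e. the law on $\mathcal M(X)$ of the infinitely divisible random measure without deterministic part whose Lévy measure is the image of $\sigma\otimes\tau_w$, $\tau_w(dr)=\frac1r e^{-\frac{1-w}{w}r}\,dr$ on $r>0$, under $(x,r)\mapsto r\delta_x$; that is, with $\kappa(f)=\int f\,d\kappa$, $$\int e^{-\kappa(f)}\,\mathrm{GP}_{w,\sigma}(d\kappa)=\exp\Bigl[-\iint\bigl(1-e^{-rf(x)}\bigr)\,\tau_w(dr)\,\sigma(dx)\Bigr]$$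 for all bounded measurable $f\ge 0$. Let $\mathrm{Poy}_{z,\rho}$ be the Pólya sum process, i.e. the probability measure on $\mathcal M^{\cdot\cdot}(X)$ such that, for all measurable $h\ge0$, $$\iint h(x,\mu)\,\mu(dx)\,\mathrm{Poy}_{z,\rho}(d\mu)=\iint h(x,\mu+\delta_x)\,z(\rho+\mu)(dx)\,\mathrm{Poy}_{z,\rho}(d\mu).$$ The kernel $\mu\mapsto z(\rho+\mu)$ is called the Pólya sum (Papangelou) kernel. All these objects exist and are unique, and $\kappa\mapsto\mathrm{Poi}_\kappa$ is a probability kernel. A Bayes kernel (posterior law of the intensity measure $\kappa$ given the observation $\mu$) for the Poisson model with prior $\mathrm{GP}_{z,\rho}$ is a probability kernel $B$ from $\mathcal M^{\cdot\cdot}(X)$ to $\mathcal M(X)$ with $$\iint f(\mu,\kappa)\,\mathrm{Poi}_\kappa(d\mu)\,\mathrm{GP}_{z,\rho}(d\kappa)=\iint f(\mu,\kappa)\,B(\mu,d\kappa)\,\mathrm{Poy}_{z,\rho}(d\mu)$$ for all measurable $f\ge0$. The Bayes estimator of the intensity measure is $b(\mu)=\int\kappa\,B(\mu,d\kappa)$,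 i.e. the intensity measure of $B(\mu,\cdot)$. **Corollary.** A Bayes kernel exists, and every Bayes kernel $B$ satisfies, for $\mathrm{Poy}_{z,\rho}$-almost every $\mu$, $$B(\mu,\cdot)=\mathrm{GP}_{\frac{z}{1+z},\,\rho+\mu}\qquad\text{and}\qquad b(\mu)=z(\rho+\mu),$$ so that the Bayes estimator is the Pólya sum kernel. Moreover, for every $\mu\in\mathcal M^{\cdot\cdot}(X)$, the intensity measure of $\mathrm{GP}_{\frac{z}{1+z},\,\rho+\mu}$ is $z(\rho+\mu)$. -/

import Mathlib

open MeasureTheory ProbabilityTheory Bornology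
open scoped ENNReal NNReal

/-- Locally finite measures on `X`: measures that are finite on bounded Borel sets. -/
def LocallyFiniteMeasure (X : Type*) [MetricSpace X] [MeasurableSpace X] : Type _ :=
  {κ : Measure X // ∀ A : Set X, MeasurableSet A → IsBounded A → κ A < ∞}

namespace LocallyFiniteMeasure

variable {X : Type*} [MetricSpace X] [MeasurableSpace X]

/-- The underlying measure. -/
def toMeasure (κ : LocallyFiniteMeasure X) : Measure X := κ.1

/-- The σ-algebra generated by the evaluations `κ ↦ κ A`, `A` a bounded Borel set. -/
instance instMeasurableSpace : MeasurableSpace (LocallyFiniteMeasure X) :=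
  ⨆ (A : Set X) (_ : MeasurableSet A) (_ : IsBounded A),
    MeasurableSpace.comap (fun κ : LocallyFiniteMeasure X => κ.toMeasure A) inferInstance

theorem measurable_eval {A : Set X} (hA : MeasurableSet A) (hb : IsBounded A) :
    Measurable (fun κ : LocallyFiniteMeasure X => κ.toMeasure A) := by
  refine Measurable.mono (comap_measurable _) ?_ le_rfl
  exact le_iSup_of_le A (le_iSup_of_le hA (le_iSup_of_le hb le_rfl))

theorem measurable_of_eval {Y : Type*} [MeasurableSpace Y] {φ : Y → LocallyFiniteMeasure X}
    (h : ∀ A : Set X, MeasurableSet A → IsBounded A →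
      Measurable (fun y => (φ y).toMeasure A)) : Measurable φ := by
  refine Measurable.of_le_map ?_
  refine iSup_le fun A => iSup_le fun hA => iSup_le fun hb => ?_
  rw [← measurable_iff_le_map, measurable_comap_iff]
  exact h A hA hb

theorem measurable_toMeasure [BorelSpace X] :
    Measurable (toMeasure : LocallyFiniteMeasure X → Measure X) := by
  refine Measure.measurable_of_measurable_coe _ fun A hA => ?_
  rcases isEmpty_or_nonempty X with hX | ⟨⟨x₀⟩⟩
  · have : A = ∅ := Set.eq_empty_of_isEmpty A
    simp [this]
  · have key : ∀ κ : LocallyFiniteMeasure X,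
        κ.toMeasure A = ⨆ n : ℕ, κ.toMeasure (A ∩ Metric.closedBall x₀ n) := by
      intro κ
      have hm : Monotone fun n : ℕ => A ∩ Metric.closedBall x₀ (n : ℝ) := by
        intro m n hmn
        exact Set.inter_subset_inter_right _ (Metric.closedBall_subset_closedBall (by exact_mod_cast hmn))
      rw [← hm.measure_iUnion, ← Set.inter_iUnion, Metric.iUnion_closedBall_nat, Set.inter_univ]
    simp only [key]
    exact Measurable.iSup fun n => measurable_eval
      (hA.inter Metric.isClosed_closedBall.measurableSet)
      (Metric.isBounded_closedBall.subset Set.inter_subset_right)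

/-- The sum of two locally finite measures. -/
instance instAdd : Add (LocallyFiniteMeasure X) where
  add κ₁ κ₂ := ⟨κ₁.toMeasure + κ₂.toMeasure, fun A hA hb => by
    rw [Measure.add_apply]
    exact ENNReal.add_lt_top.2 ⟨κ₁.2 A hA hb, κ₂.2 A hA hb⟩⟩

/-- The map `χ : (x, r) ↦ r δ_x` (for `r ≥ 0`). -/
noncomputable def scaledDirac (p : X × ℝ) : LocallyFiniteMeasure X :=
  ⟨ENNReal.ofReal p.2 • Measure.dirac p.1, fun A hA _ => by
    rw [Measure.smul_apply, smul_eq_mul]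
    exact ENNReal.mul_lt_top ENNReal.ofReal_lt_top (measure_lt_top _ _)⟩

theorem measurable_scaledDirac :
    Measurable (scaledDirac : X × ℝ → LocallyFiniteMeasure X) := by
  refine measurable_of_eval fun A hA _ => ?_
  have : ∀ p : X × ℝ, (scaledDirac p).toMeasure A =
      ENNReal.ofReal p.2 * A.indicator 1 p.1 := by
    intro p
    simp [scaledDirac, toMeasure, Measure.dirac_apply' _ hA]
  simp only [this]
  exact (ENNReal.measurable_ofReal.comp measurable_snd).mul
    ((measurable_one.indicator hA).comp measurable_fst)

end LocallyFiniteMeasure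

/-- Locally finite point measures on `X`: locally finite measures taking integer values on
bounded Borel sets, i.e. locally finite configurations of points with multiplicities.  The
σ-algebra is the trace of that on `LocallyFiniteMeasure X`. -/
def PointMeasure (X : Type*) [MetricSpace X] [MeasurableSpace X] : Type _ :=
  {μ : LocallyFiniteMeasure X // ∀ A : Set X, MeasurableSet A → IsBounded A →
    ∃ n : ℕ, μ.toMeasure A = n}

namespace PointMeasure

variable {X : Type*} [MetricSpace X] [MeasurableSpace X]

/-- A point measure as a locally finite measure. -/
def toLocallyFinite (μ : PointMeasure X) : LocallyFiniteMeasure X := μ.1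

/-- The underlying measure. -/
def toMeasure (μ : PointMeasure X) : Measure X := μ.toLocallyFinite.toMeasure

instance instMeasurableSpace : MeasurableSpace (PointMeasure X) :=
  MeasurableSpace.comap toLocallyFinite inferInstance

/-- The configuration `μ + δ_x` with one more point at `x`. -/
noncomputable def addDirac (μ : PointMeasure X) (x : X) : PointMeasure X :=
  ⟨⟨μ.toMeasure + Measure.dirac x, fun A hA hb => by
      rw [Measure.add_apply]
      exact ENNReal.add_lt_top.2 ⟨μ.1.2 A hA hb, measure_lt_top _ _⟩⟩, fun A hA hb => by
      obtain ⟨n, hn⟩ := μ.2 A hA hb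
      have hn' : μ.toMeasure A = n := hn
      by_cases hx : x ∈ A
      · refine ⟨n + 1, ?_⟩
        simp [LocallyFiniteMeasure.toMeasure, hn', Measure.dirac_apply' _ hA, hx]
      · refine ⟨n, ?_⟩
        simp [LocallyFiniteMeasure.toMeasure, hn', Measure.dirac_apply' _ hA, hx]⟩

end PointMeasure

section Processes

variable {X : Type*} [MetricSpace X] [MeasurableSpace X]

/-- `P` is (the law of) the Poisson process with intensity measure `κ`: the number of points in a
bounded Borel set `A` is Poisson distributed with mean `κ A`, and the numbers of points in
disjoint bounded Borel sets are independent. -/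
structure IsPoissonProcess (κ : LocallyFiniteMeasure X) (P : Measure (PointMeasure X)) : Prop where
  isProbabilityMeasure : IsProbabilityMeasure P
  map_eval : ∀ A : Set X, MeasurableSet A → IsBounded A →
    P.map (fun μ => μ.toMeasure A) =
      (poissonMeasure (κ.toMeasure A).toNNReal).map (fun n : ℕ => (n : ℝ≥0∞))
  indep : ∀ (n : ℕ) (A : Fin n → Set X), (∀ i, MeasurableSet (A i)) → (∀ i, IsBounded (A i)) →
    (∀ i j, i ≠ j → Disjoint (A i) (A j)) →
    iIndepFun (fun i (μ : PointMeasure X) => μ.toMeasure (A i)) P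

/-- The kernel `μ ↦ z (ρ + μ)`. -/
noncomputable def polyaSumKernel (z : ℝ) (ρ : LocallyFiniteMeasure X) (μ : PointMeasure X) :
    Measure X :=
  ENNReal.ofReal z • (ρ.toMeasure + μ.toMeasure)

/-- `P` is (the law of) the Pólya sum process for `z` and `ρ`: a point process with Papangelou
kernel `z (ρ + μ)`, i.e. its Campbell measure satisfies
`∬ h(x, μ) μ(dx) P(dμ) = ∬ h(x, μ + δ_x) z(ρ + μ)(dx) P(dμ)` for measurable `h ≥ 0`. -/
structure IsPolyaSumProcess (z : ℝ) (ρ : LocallyFiniteMeasure X) (P : Measure (PointMeasure X)) :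
    Prop where
  isProbabilityMeasure : IsProbabilityMeasure P
  campbell : ∀ h : X × PointMeasure X → ℝ≥0∞, Measurable h →
    ∫⁻ μ, ∫⁻ x, h (x, μ) ∂μ.toMeasure ∂P =
      ∫⁻ μ, ∫⁻ x, h (x, μ.addDirac x) ∂(polyaSumKernel z ρ μ) ∂P

/-- `e^{-t}` for `t ∈ [0, ∞]`, with `e^{-∞} = 0`. -/
noncomputable def expNeg (t : ℝ≥0∞) : ℝ≥0∞ := EReal.exp (-(t : EReal))

/-- `G` is the infinitely divisible random measure (without deterministic part) with Lévy measure
`L`: its Laplace transform is `f ↦ exp (-∫ (1 - e^{-ν(f)}) L(dν))`, for bounded measurable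
`f ≥ 0`. -/
structure IsInfinitelyDivisibleWith (L G : Measure (LocallyFiniteMeasure X)) : Prop where
  isProbabilityMeasure : IsProbabilityMeasure G
  laplace : ∀ f : X → ℝ≥0, Measurable f → (∃ C : ℝ≥0, ∀ x, f x ≤ C) →
    ∫⁻ κ, expNeg (∫⁻ x, f x ∂κ.toMeasure) ∂G =
      expNeg (∫⁻ ν, (1 - expNeg (∫⁻ x, f x ∂ν.toMeasure)) ∂L)

/-- The measure `τ_z(dr) = r⁻¹ exp (-((1 - z) / z) r) dr` on `r > 0`. -/
noncomputable def gammaLevy (z : ℝ) : Measure ℝ :=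
  (volume.restrict (Set.Ioi 0)).withDensity
    (fun r => ENNReal.ofReal (r⁻¹ * Real.exp (-((1 - z) / z) * r)))

/-- `G` is (the law of) the Poisson-Gamma random measure for `z` and `ρ`: infinitely divisible
with Lévy measure the image of `ρ ⊗ τ_z` under `(x, r) ↦ r δ_x`. -/
def IsPoissonGamma (z : ℝ) (ρ : LocallyFiniteMeasure X) (G : Measure (LocallyFiniteMeasure X)) :
    Prop :=
  IsInfinitelyDivisibleWith
    ((ρ.toMeasure.prod (gammaLevy z)).map LocallyFiniteMeasure.scaledDirac) G

/-- The intensity measure `∫ κ G(dκ)` of a random measure `G`. -/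
noncomputable def intensityMeasure (G : Measure (LocallyFiniteMeasure X)) : Measure X :=
  G.bind LocallyFiniteMeasure.toMeasure

theorem intensityMeasure_apply [BorelSpace X] (G : Measure (LocallyFiniteMeasure X))
    {A : Set X} (hA : MeasurableSet A) :
    intensityMeasure G A = ∫⁻ κ, κ.toMeasure A ∂G :=
  Measure.bind_apply hA LocallyFiniteMeasure.measurable_toMeasure.aemeasurable

/-- `B` is a Bayes kernel (a version of the posterior law of the parameter `κ` given the
observation `μ`) for the statistical model `model`, the prior `prior` on the parameters `κ` and
the law `marginal` of the observation:
`∬ f(μ, κ) model_κ(dμ) prior(dκ) = ∬ f(μ, κ) B(μ, dκ) marginal(dμ)` for measurable `f ≥ 0`. -/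
structure IsBayesKernel (model : Kernel (LocallyFiniteMeasure X) (PointMeasure X))
    (prior : Measure (LocallyFiniteMeasure X)) (marginal : Measure (PointMeasure X))
    (B : Kernel (PointMeasure X) (LocallyFiniteMeasure X)) : Prop where
  isMarkovKernel : IsMarkovKernel B
  disintegration : ∀ f : PointMeasure X × LocallyFiniteMeasure X → ℝ≥0∞, Measurable f →
    ∫⁻ κ, ∫⁻ μ, f (μ, κ) ∂(model κ) ∂prior = ∫⁻ μ, ∫⁻ κ, f (μ, κ) ∂(B μ) ∂marginal

/-- The Bayes estimator `μ ↦ ∫ κ B(μ, dκ)` of the intensity measure. -/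
noncomputable def bayesEstimator (B : Kernel (PointMeasure X) (LocallyFiniteMeasure X))
    (μ : PointMeasure X) : Measure X :=
  intensityMeasure (B μ)

end Processes

/-! Everything is read off Laplace transforms. With `γ_c(s) = log (1 + c s)`, the Frullani integral
gives `GP_{w,σ}` the transform `f ↦ exp (-σ(γ_{w/(1-w)}(f)))` (`isPoissonGamma_iff`). Integrating
the Poisson transform over the prior, the joint transform of observation and parameter, `E exp
(-μ(f) - κ(g))`, is `exp (-ρ(γ_{z/(1-z)}(g + 1 - e^{-f})))`. The algebraic identity `1 + z/(1-z) (g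
+ 1 - e^{-f}) = (1 + z g) (1 + z/(1-z) (1 - e^{-f}/(1 + z g)))` splits this into `exp (-ρ(γ_z(g)))`
times the transform of the marginal law of `μ` at `f + γ_z(g)`, which is the mean of `e^{-μ(f)} exp
(-(ρ+μ)(γ_z(g)))` under that marginal. Since `w = z/(1+z)` has `w/(1-w) = z`, the last factor is the
transform of `GP_{z/(1+z),ρ+μ}`: this is the posterior (`joint_eq_compProd`). Differentiating its
transform at `0` gives the mean `z(ρ+μ)`.

The marginal is the Pólya sum process: by the Mecke formula, `μ(dx)` may be replaced by `κ(dx)` if a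
point is added at `x`, and integrating `κ` out under the posterior leaves its mean `z(ρ+μ)`
(`isPolyaSumProcess_cox`). The Campbell identity determines a process, because it gives a recursion
for the joint law of the counts in disjoint bounded sets (`IsPolyaSumProcess.eq`).

Existence rests on one construction, the Poisson random measure on an s-finite space: it yields the
Poisson process directly, and the Poisson-Gamma measure as the sum of the jumps `r δ_x` over its
atoms `(x, r)`. Almost sure uniqueness of the Bayes kernel holds because the σ-algebra on
`LocallyFiniteMeasure X` is countably generated. -/

set_option linter.unusedSectionVars false

/-! ### The exponential `e^{-t}` on `[0, ∞]`. -/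

section ExpNeg

theorem expNeg_eq_inv_exp (t : ℝ≥0∞) : expNeg t = (EReal.exp (t : EReal))⁻¹ := by
  rw [expNeg, EReal.exp_neg]

@[simp] theorem expNeg_zero : expNeg 0 = 1 := by simp [expNeg]

@[simp] theorem expNeg_top : expNeg ∞ = 0 := by simp [expNeg]

theorem expNeg_add (s t : ℝ≥0∞) : expNeg (s + t) = expNeg s * expNeg t := by
  simp only [expNeg_eq_inv_exp, EReal.coe_ennreal_add, EReal.exp_add]
  rw [ENNReal.mul_inv]
  · left; simp
  · right; simp

theorem expNeg_ofReal {t : ℝ} (ht : 0 ≤ t) :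
    expNeg (ENNReal.ofReal t) = ENNReal.ofReal (Real.exp (-t)) := by
  rw [expNeg, EReal.coe_ennreal_ofReal, max_eq_left ht, ← EReal.coe_neg, EReal.exp_coe]

theorem expNeg_coe (t : ℝ≥0) : expNeg t = ENNReal.ofReal (Real.exp (-t)) := by
  rw [← ENNReal.ofReal_coe_nnreal, expNeg_ofReal t.coe_nonneg]

theorem expNeg_antitone : Antitone expNeg := fun s t h => by
  rw [expNeg, expNeg, EReal.exp_le_exp_iff, EReal.neg_le_neg_iff]
  exact_mod_cast h

theorem expNeg_injective : Function.Injective expNeg := fun s t h => by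
  have := EReal.exp_strictMono.injective h
  simpa using this

theorem expNeg_le_one (t : ℝ≥0∞) : expNeg t ≤ 1 := by
  rw [← expNeg_zero]; exact expNeg_antitone (zero_le)

theorem expNeg_ne_top (t : ℝ≥0∞) : expNeg t ≠ ∞ :=
  ((expNeg_le_one t).trans_lt ENNReal.one_lt_top).ne

theorem continuous_expNeg : Continuous expNeg :=
  ENNReal.continuous_exp.comp (continuous_coe_ennreal_ereal.neg)

@[fun_prop] theorem measurable_expNeg : Measurable expNeg := continuous_expNeg.measurable

/-- Passing from `Y` to `e^{-Y}` loses no information, even where `Y = ∞`: both generate the same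
σ-algebra. This is why Laplace exponentials suffice as test functions. -/
theorem measurableEmbedding_expNeg : MeasurableEmbedding expNeg :=
  continuous_expNeg.measurableEmbedding expNeg_injective

theorem expNeg_sum {ι : Type*} (s : Finset ι) (f : ι → ℝ≥0∞) :
    expNeg (∑ i ∈ s, f i) = ∏ i ∈ s, expNeg (f i) := by
  classical
  induction s using Finset.induction_on with
  | empty => simp
  | insert a s ha ih => rw [Finset.sum_insert ha, Finset.prod_insert ha, expNeg_add, ih]

end ExpNeg

/-! ### Multiplicative systems of test functions. -/

section MultiplicativeSystem

open Filter Topology Polynomial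

/-- The indicator of `(a, ∞)` is on `[0, 1]` a bounded pointwise limit of polynomials. -/
theorem exists_polynomial_tendsto_indicator_Ioi (a : ℝ) :
    ∃ p : ℕ → ℝ[X], (∀ n, ∀ u ∈ Set.Icc (0 : ℝ) 1, |(p n).eval u| ≤ 2) ∧
      ∀ u ∈ Set.Icc (0 : ℝ) 1,
        Tendsto (fun n => (p n).eval u) atTop (𝓝 ((Set.Ioi a).indicator 1 u)) := by
  -- Continuous ramps with values in `[0, 1]` tending to the indicator. Weierstrass approximates
  -- them with error below `1/(n+1) ≤ 1`, whence the bound `2`.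
  set φ : ℕ → ℝ → ℝ := fun n u => min 1 (n * max 0 (u - a)) with hφ
  have hφc : ∀ n, Continuous (φ n) := fun n => by fun_prop
  have hφ0 : ∀ n u, 0 ≤ φ n u := fun n u => by simp only [hφ]; positivity
  have hφ1 : ∀ n u, φ n u ≤ 1 := fun n u => min_le_left _ _
  have h : ∀ n : ℕ, ∃ p : ℝ[X], ∀ u ∈ Set.Icc (0 : ℝ) 1, |p.eval u - φ n u| < 1 / (n + 1 : ℝ) :=
    fun n => exists_polynomial_near_of_continuousOn 0 1 (φ n) (hφc n).continuousOn _
      (by positivity)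
  choose p hp using h
  refine ⟨p, fun n u hu => ?_, fun u hu => ?_⟩
  · have h1 := hp n u hu
    have h2 : 1 / (n + 1 : ℝ) ≤ 1 := by
      rw [div_le_one (by positivity)]; linarith [(Nat.cast_nonneg n : (0 : ℝ) ≤ n)]
    rw [abs_lt] at h1
    rw [abs_le]
    constructor <;> linarith [h1.1, h1.2, hφ0 n u, hφ1 n u]
  · have h1 : Tendsto (fun n => (p n).eval u - φ n u) atTop (𝓝 0) :=
      squeeze_zero_norm (fun n => (hp n u hu).le) tendsto_one_div_add_atTop_nhds_zero_nat
    have h2 : Tendsto (fun n => φ n u) atTop (𝓝 ((Set.Ioi a).indicator 1 u)) := by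
      by_cases hua : a < u
      · rw [Set.indicator_of_mem (by exact hua)]
        refine tendsto_const_nhds.congr' ?_
        obtain ⟨N, hN⟩ := exists_nat_gt (1 / (u - a))
        filter_upwards [eventually_ge_atTop N] with n hn
        have hpos : 0 < u - a := sub_pos.2 hua
        simp only [hφ, Pi.one_apply]
        rw [max_eq_right hpos.le, min_eq_left]
        have : (N : ℝ) ≤ n := by exact_mod_cast hn
        have h3 : 1 / (u - a) ≤ n := (hN.trans_le this).le
        rwa [div_le_iff₀ hpos] at h3
      · rw [Set.indicator_of_notMem (by exact hua)]
        have : ∀ n, φ n u = 0 := fun n => by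
          simp only [hφ]; rw [max_eq_left (by linarith)]; simp
        simp [this]
    simpa using h1.add h2

variable {Y Z : Type*} [MeasurableSpace Y] [mZ : MeasurableSpace Z]

/-- A multiplicative system theorem: a family of finite measures is measurable as soon as the
integrals of a multiplicative system of `[0, 1]`-valued functions generating the σ-algebra are. -/
theorem measurable_measure_of_multiplicative {E : Set (Z → ℝ≥0∞)}
    (hE1 : (fun _ => 1) ∈ E) (hEmul : ∀ e ∈ E, ∀ e' ∈ E, (fun z => e z * e' z) ∈ E)
    (hEle : ∀ e ∈ E, ∀ z, e z ≤ 1) (hEm : ∀ e ∈ E, Measurable e)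
    (hgen : mZ ≤ ⨆ e ∈ E, MeasurableSpace.comap e inferInstance)
    (K : Y → Measure Z) [hK : ∀ y, IsFiniteMeasure (K y)]
    (hint : ∀ e ∈ E, Measurable fun y => ∫⁻ z, e z ∂(K y)) : Measurable K := by
  -- As the system is closed under products, the algebra it generates is its linear span, so that
  -- integrals over elements of the algebra are controlled by linearity.
  let M : Submonoid (Z → ℝ) :=
    { carrier := {g | ∃ e ∈ E, g = fun z => (e z).toReal}
      one_mem' := ⟨_, hE1, by ext; simp⟩
      mul_mem' := by
        rintro _ _ ⟨e, he, rfl⟩ ⟨e', he', rfl⟩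
        exact ⟨_, hEmul e he e' he', by ext; simp⟩ }
  let A : Subalgebra ℝ (Z → ℝ) := Algebra.adjoin ℝ (M : Set (Z → ℝ))
  -- elements of the algebra are measurable, bounded, with measurable integrals
  have hA : ∀ g ∈ A, Measurable g ∧ (∃ C, ∀ z, |g z| ≤ C) ∧
      Measurable fun y => ∫ z, g z ∂(K y) := by
    intro g hg
    have hg' : g ∈ Submodule.span ℝ (M : Set (Z → ℝ)) := by
      have : g ∈ Subalgebra.toSubmodule A := hg
      rwa [Algebra.adjoin_eq_span, Submonoid.closure_eq] at this
    have hI : ∀ g : Z → ℝ, Measurable g → (∃ C, ∀ z, |g z| ≤ C) → ∀ y, Integrable g (K y) := by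
      rintro g hgm ⟨C, hC⟩ y
      exact Integrable.of_bound hgm.aestronglyMeasurable C (ae_of_all _ hC)
    clear hg
    induction hg' using Submodule.span_induction with
    | mem g hg =>
      obtain ⟨e, he, rfl⟩ := hg
      refine ⟨(hEm e he).ennreal_toReal, ⟨1, fun z => ?_⟩, ?_⟩
      · rw [abs_of_nonneg ENNReal.toReal_nonneg]
        exact ENNReal.toReal_le_of_le_ofReal zero_le_one (by simpa using hEle e he z)
      · have : ∀ y, ∫ z, (e z).toReal ∂(K y) = (∫⁻ z, e z ∂(K y)).toReal := fun y =>
          integral_toReal (hEm e he).aemeasurable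
            (ae_of_all _ fun z => (hEle e he z).trans_lt ENNReal.one_lt_top)
        simp only [this]
        exact (hint e he).ennreal_toReal
    | zero => exact ⟨measurable_zero, ⟨0, by simp⟩, by simp⟩
    | add g g' hg hg' ih ih' =>
      obtain ⟨h1, ⟨C, hC⟩, h3⟩ := ih
      obtain ⟨h1', ⟨C', hC'⟩, h3'⟩ := ih'
      refine ⟨h1.add h1', ⟨C + C', fun z => (abs_add_le _ _).trans (add_le_add (hC z) (hC' z))⟩, ?_⟩
      have : ∀ y, ∫ z, (g + g') z ∂(K y) = ∫ z, g z ∂(K y) + ∫ z, g' z ∂(K y) := fun y =>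
        integral_add (hI g h1 ⟨C, hC⟩ y) (hI g' h1' ⟨C', hC'⟩ y)
      simp only [this]
      exact h3.add h3'
    | smul c g hg ih =>
      obtain ⟨h1, ⟨C, hC⟩, h3⟩ := ih
      refine ⟨h1.const_smul c, ⟨|c| * C, fun z => ?_⟩, ?_⟩
      · simp only [Pi.smul_apply, smul_eq_mul, abs_mul]
        exact mul_le_mul_of_nonneg_left (hC z) (abs_nonneg c)
      · simp only [Pi.smul_apply, integral_smul]
        exact h3.const_smul c
  -- Sets whose indicator is a bounded pointwise limit from the algebra. Products of the
  -- approximants give a π-system, and dominated convergence handles the measures of its members.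
  let P : Set (Set Z) := {S | ∃ g : ℕ → Z → ℝ, (∀ n, g n ∈ A) ∧ (∃ C, ∀ n z, |g n z| ≤ C) ∧
    ∀ z, Tendsto (fun n => g n z) atTop (𝓝 (S.indicator 1 z))}
  have hPm : ∀ S ∈ P, MeasurableSet S := by
    rintro S ⟨g, hg, -, hlim⟩
    have : Measurable (S.indicator (1 : Z → ℝ)) :=
      measurable_of_tendsto_metrizable (fun n => (hA _ (hg n)).1) (tendsto_pi_nhds.2 hlim)
    have h2 : S = S.indicator (1 : Z → ℝ) ⁻¹' {1} := by
      ext z; by_cases hz : z ∈ S <;> simp [hz]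
    rw [h2]; exact this (measurableSet_singleton _)
  have hPpi : IsPiSystem P := by
    rintro S ⟨g, hg, ⟨C, hC⟩, hlim⟩ T ⟨g', hg', ⟨C', hC'⟩, hlim'⟩ -
    refine ⟨fun n => g n * g' n, fun n => A.mul_mem (hg n) (hg' n), ⟨C * C', fun n z => ?_⟩,
      fun z => ?_⟩
    · simp only [Pi.mul_apply, abs_mul]
      exact mul_le_mul (hC n z) (hC' n z) (abs_nonneg _) ((abs_nonneg _).trans (hC n z))
    · rw [Set.inter_indicator_one]
      exact (hlim z).mul (hlim' z)
  have hPuniv : Set.univ ∈ P :=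
    ⟨fun _ => 1, fun n => A.one_mem, ⟨1, by simp⟩, fun z => by simp⟩
  have hPgen : mZ = MeasurableSpace.generateFrom P := by
    refine le_antisymm (hgen.trans ?_) (MeasurableSpace.generateFrom_le hPm)
    refine iSup₂_le fun e he => ?_
    rw [← measurable_iff_comap_le]
    have hreal : Measurable[MeasurableSpace.generateFrom P] fun z => (e z).toReal := by
      -- The superlevel sets of `e` belong to `P`: polynomials in `e` stay in the algebra and
      -- approximate the indicator of `{e > a}`.
      refine @measurable_of_Ioi ℝ Z _ _ _ (MeasurableSpace.generateFrom P) _ _ _ _ fun a => ?_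
      refine MeasurableSpace.measurableSet_generateFrom ?_
      obtain ⟨p, hpb, hpl⟩ := exists_polynomial_tendsto_indicator_Ioi a
      have hmem : ∀ z, (e z).toReal ∈ Set.Icc (0 : ℝ) 1 := fun z =>
        ⟨ENNReal.toReal_nonneg,
          ENNReal.toReal_le_of_le_ofReal zero_le_one (by simpa using hEle e he z)⟩
      have heA : (fun z => (e z).toReal) ∈ A := Algebra.subset_adjoin ⟨e, he, rfl⟩
      refine ⟨fun n z => (p n).eval (e z).toReal, fun n => ?_, ⟨2, fun n z => hpb n _ (hmem z)⟩,
        fun z => hpl _ (hmem z)⟩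
      have := Polynomial.aeval_mem_adjoin_singleton ℝ (p := p n) (fun z => (e z).toReal)
      have h2 := Algebra.adjoin_le (Set.singleton_subset_iff.2 heA) this
      convert h2 using 1
      ext z
      simp [Polynomial.aeval_def, Polynomial.eval₂_eq_sum, Polynomial.eval_eq_sum,
        Polynomial.sum_def]
    have : e = fun z => ENNReal.ofReal (e z).toReal := by
      ext z; rw [ENNReal.ofReal_toReal ((hEle e he z).trans_lt ENNReal.one_lt_top).ne]
    rw [this]
    exact ENNReal.measurable_ofReal.comp hreal
  have hval : ∀ S ∈ P, Measurable fun y => K y S := by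
    rintro S hS
    have hSm := hPm S hS
    obtain ⟨g, hg, ⟨C, hC⟩, hlim⟩ := hS
    have h1 : ∀ y, Tendsto (fun n => ∫ z, g n z ∂(K y)) atTop (𝓝 ((K y).real S)) := by
      intro y
      have := tendsto_integral_of_dominated_convergence (μ := K y) (fun _ => C)
        (fun n => (hA _ (hg n)).1.aestronglyMeasurable) (integrable_const C)
        (fun n => ae_of_all _ (hC n)) (ae_of_all _ hlim)
      rwa [integral_indicator_one hSm] at this
    have h2 : Measurable fun y => (K y).real S :=
      measurable_of_tendsto_metrizable (fun n => (hA _ (hg n)).2.2) (tendsto_pi_nhds.2 h1)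
    have h3 : (fun y => K y S) = fun y => ENNReal.ofReal ((K y).real S) := by
      ext y; simp [Measure.real]
    rw [h3]; exact ENNReal.measurable_ofReal.comp h2
  refine Measure.measurable_of_measurable_coe _ fun S hS => ?_
  induction S, hS using MeasurableSpace.induction_on_inter hPgen hPpi with
  | empty => simp
  | basic S hS => exact hval S hS
  | compl S hS ih =>
    simp only [measure_compl hS (measure_ne_top _ _)]
    exact (hval _ hPuniv).sub ih
  | iUnion f hd hf ih =>
    simp only [measure_iUnion hd hf]
    exact Measurable.tsum ih

/-- A finite measure is determined by the integrals of a multiplicative system of `[0, 1]`-valued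
functions generating the σ-algebra. -/
theorem measure_ext_of_multiplicative {E : Set (Z → ℝ≥0∞)}
    (hE1 : (fun _ => 1) ∈ E) (hEmul : ∀ e ∈ E, ∀ e' ∈ E, (fun z => e z * e' z) ∈ E)
    (hEle : ∀ e ∈ E, ∀ z, e z ≤ 1) (hEm : ∀ e ∈ E, Measurable e)
    (hgen : mZ ≤ ⨆ e ∈ E, MeasurableSpace.comap e inferInstance)
    (P Q : Measure Z) [IsFiniteMeasure P] [IsFiniteMeasure Q]
    (hint : ∀ e ∈ E, ∫⁻ z, e z ∂P = ∫⁻ z, e z ∂Q) : P = Q := by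
  -- Uniqueness is an instance of measurability: over `Bool` with the trivial σ-algebra, measurable
  -- functions are constant. The hypothesis on integrals says precisely that they are measurable in
  -- this sense.
  let K : Bool → Measure Z := fun b => if b then P else Q
  have hK : ∀ b, IsFiniteMeasure (K b) := by
    rintro (_ | _)
    exacts [inferInstanceAs (IsFiniteMeasure Q), inferInstanceAs (IsFiniteMeasure P)]
  have hconst : ∀ g : Bool → ℝ≥0∞, Measurable[⊥] g → g true = g false := by
    intro g hg
    have h := hg (measurableSet_singleton (g true))
    rw [MeasurableSpace.measurableSet_bot_iff] at h
    have ht : true ∈ g ⁻¹' {g true} := rfl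
    rcases h with h | h
    · rw [h] at ht; exact ht.elim
    · have : false ∈ g ⁻¹' {g true} := by rw [h]; trivial
      exact this.symm
  have hKm := @measurable_measure_of_multiplicative Bool Z ⊥ _ E hE1 hEmul hEle hEm hgen K hK
    (fun e he => by
      have : (fun b => ∫⁻ z, e z ∂(K b)) = fun _ => ∫⁻ z, e z ∂P := by
        ext b; cases b <;> simp [K, hint e he]
      rw [this]; exact @measurable_const _ _ _ ⊥ _)
  ext S hS
  exact hconst (fun b => K b S) ((Measure.measurable_coe hS).comp hKm)

end MultiplicativeSystem

/-! ### Laplace functionals: uniqueness, measurability, differentiation. -/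

section Laplace

open Filter Topology

/-- The law of a finite family of `[0, ∞]`-valued random variables is determined by its Laplace
transform. -/
theorem measure_pi_ext_of_laplace {ι : Type*} [Fintype ι] {P Q : Measure (ι → ℝ≥0∞)}
    [IsFiniteMeasure P] [IsFiniteMeasure Q]
    (h : ∀ t : ι → ℝ≥0, ∫⁻ x, expNeg (∑ i, t i * x i) ∂P = ∫⁻ x, expNeg (∑ i, t i * x i) ∂Q) :
    P = Q := by
  classical
  refine measure_ext_of_multiplicative
    (E := {e | ∃ t : ι → ℝ≥0, e = fun x => expNeg (∑ i, t i * x i)}) ⟨0, by simp⟩ ?_ ?_ ?_ ?_ P Q ?_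
  · rintro _ ⟨t, rfl⟩ _ ⟨t', rfl⟩
    refine ⟨t + t', ?_⟩
    ext x
    rw [← expNeg_add, ← Finset.sum_add_distrib]
    simp [add_mul]
  · rintro _ ⟨t, rfl⟩ z; exact expNeg_le_one _
  · rintro _ ⟨t, rfl⟩; fun_prop
  · refine iSup_le fun i => ?_
    refine le_iSup₂_of_le (fun x : ι → ℝ≥0∞ => expNeg (x i))
      ⟨fun j => if j = i then 1 else 0, by ext x; simp [apply_ite ENNReal.ofNNReal]⟩ ?_
    have : (fun x : ι → ℝ≥0∞ => expNeg (x i)) = expNeg ∘ fun x => x i := rfl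
    rw [this, ← MeasurableSpace.comap_comp, measurableEmbedding_expNeg.comap_eq]
  · rintro _ ⟨t, rfl⟩; exact h t

theorem measure_ennreal_ext_of_laplace {P Q : Measure ℝ≥0∞} [IsFiniteMeasure P] [IsFiniteMeasure Q]
    (h : ∀ t : ℝ≥0, ∫⁻ x, expNeg (t * x) ∂P = ∫⁻ x, expNeg (t * x) ∂Q) : P = Q := by
  refine measure_ext_of_multiplicative
    (E := {e | ∃ t : ℝ≥0, e = fun x => expNeg (t * x)}) ⟨0, by simp⟩ ?_ ?_ ?_ ?_ P Q ?_
  · rintro _ ⟨t, rfl⟩ _ ⟨t', rfl⟩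
    refine ⟨t + t', ?_⟩
    ext x
    rw [← expNeg_add]
    simp [add_mul]
  · rintro _ ⟨t, rfl⟩ z; exact expNeg_le_one _
  · rintro _ ⟨t, rfl⟩; fun_prop
  · refine le_iSup₂_of_le (fun x : ℝ≥0∞ => expNeg x) ⟨1, by ext x; simp⟩ ?_
    exact measurableEmbedding_expNeg.comap_eq.ge
  · rintro _ ⟨t, rfl⟩; exact h t

variable {X : Type*} [MetricSpace X] [MeasurableSpace X]

namespace LocallyFiniteMeasure

@[fun_prop]
theorem measurable_lintegral [BorelSpace X] {f : X → ℝ≥0∞} (hf : Measurable f) :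
    Measurable fun κ : LocallyFiniteMeasure X => ∫⁻ x, f x ∂κ.toMeasure :=
  (Measure.measurable_lintegral hf).comp measurable_toMeasure

instance [BorelSpace X] (κ : LocallyFiniteMeasure X) : SigmaFinite κ.toMeasure := by
  rcases isEmpty_or_nonempty X with hX | ⟨⟨x₀⟩⟩
  · rw [Measure.eq_zero_of_isEmpty κ.toMeasure]; infer_instance
  · exact ⟨⟨{ set := fun n : ℕ => Metric.closedBall x₀ n
              set_mem := fun _ => trivial
              finite := fun n => κ.2 _ Metric.isClosed_closedBall.measurableSet
                Metric.isBounded_closedBall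
              spanning := Metric.iUnion_closedBall_nat x₀ }⟩⟩

theorem toMeasure_add (κ κ' : LocallyFiniteMeasure X) :
    (κ + κ').toMeasure = κ.toMeasure + κ'.toMeasure := rfl

/-- The exponentials `e^{-κ(f)}` generate the σ-algebra. -/
theorem le_iSup_comap_laplace {Z : Type*} (T : Z → LocallyFiniteMeasure X)
    {E : Set (Z → ℝ≥0∞)}
    (hE : ∀ f : SimpleFunc X ℝ≥0, IsBounded (Function.support f) →
      (fun z => expNeg (∫⁻ x, f x ∂(T z).toMeasure)) ∈ E) :
    MeasurableSpace.comap T inferInstance ≤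
      ⨆ e ∈ E, MeasurableSpace.comap e inferInstance := by
  simp only [instMeasurableSpace, MeasurableSpace.comap_iSup, MeasurableSpace.comap_comp]
  refine iSup_le fun A => iSup_le fun hA => iSup_le fun hb => ?_
  let f : SimpleFunc X ℝ≥0 := SimpleFunc.piecewise A hA (SimpleFunc.const X 1) 0
  have hf : ∀ x, ((f x : ℝ≥0) : ℝ≥0∞) = A.indicator 1 x := by
    intro x; by_cases hx : x ∈ A <;> simp [f, hx]
  have hfs : IsBounded (Function.support f) := by
    refine hb.subset fun x hx => ?_
    by_contra hxA
    exact hx (by simp [f, hxA])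
  refine le_iSup₂_of_le _ (hE f hfs) ?_
  have : (fun z => expNeg (∫⁻ x, f x ∂(T z).toMeasure)) =
      expNeg ∘ ((fun κ : LocallyFiniteMeasure X => κ.toMeasure A) ∘ T) := by
    ext z; simp [hf, lintegral_indicator_one hA]
  rw [this]
  conv_rhs => rw [← MeasurableSpace.comap_comp, measurableEmbedding_expNeg.comap_eq]

end LocallyFiniteMeasure

open LocallyFiniteMeasure

section Pairs

variable [BorelSpace X] {Y Z : Type*} [MeasurableSpace Y] [mZ : MeasurableSpace Z]
  {S T : Z → LocallyFiniteMeasure X}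

/-- The multiplicative system of the exponentials `e^{-S(f) - T(g)}`, for simple functions `f` and
`g` of bounded support. -/
def laplaceSystem (S T : Z → LocallyFiniteMeasure X) : Set (Z → ℝ≥0∞) :=
  {e | ∃ f g : SimpleFunc X ℝ≥0, IsBounded (Function.support f) ∧ IsBounded (Function.support g) ∧
    e = fun z => expNeg (∫⁻ x, f x ∂(S z).toMeasure + ∫⁻ x, g x ∂(T z).toMeasure)}

theorem isBounded_support_add {f g : SimpleFunc X ℝ≥0} (hf : IsBounded (Function.support f))
    (hg : IsBounded (Function.support g)) : IsBounded (Function.support (f + g : SimpleFunc X ℝ≥0)) :=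
  (hf.union hg).subset (by simpa using Function.support_add f g)

theorem SimpleFunc.measurable_coe_ennreal (f : SimpleFunc X ℝ≥0) :
    Measurable fun x => (f x : ℝ≥0∞) := measurable_coe_nnreal_ennreal.comp f.measurable

theorem lintegral_simpleFunc_add (f g : SimpleFunc X ℝ≥0) (μ : Measure X) :
    ∫⁻ x, ((f + g : SimpleFunc X ℝ≥0) x : ℝ≥0∞) ∂μ = ∫⁻ x, f x ∂μ + ∫⁻ x, g x ∂μ := by
  simp only [SimpleFunc.coe_add, Pi.add_apply, ENNReal.coe_add]
  exact lintegral_add_left (SimpleFunc.measurable_coe_ennreal f) _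

theorem laplaceSystem_one : (fun _ => 1) ∈ laplaceSystem S T :=
  ⟨0, 0, by simp, by simp, by simp⟩

theorem laplaceSystem_mul : ∀ e ∈ laplaceSystem S T, ∀ e' ∈ laplaceSystem S T,
    (fun z => e z * e' z) ∈ laplaceSystem S T := by
  rintro _ ⟨f, g, hf, hg, rfl⟩ _ ⟨f', g', hf', hg', rfl⟩
  refine ⟨f + f', g + g', isBounded_support_add hf hf', isBounded_support_add hg hg', ?_⟩
  ext z
  rw [← expNeg_add, lintegral_simpleFunc_add, lintegral_simpleFunc_add, add_add_add_comm]

theorem laplaceSystem_le : ∀ e ∈ laplaceSystem S T, ∀ z, e z ≤ 1 := by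
  rintro _ ⟨f, g, -, -, rfl⟩ z; exact expNeg_le_one _

theorem laplaceSystem_measurable (hS : Measurable S) (hT : Measurable T) :
    ∀ e ∈ laplaceSystem S T, Measurable e := by
  rintro _ ⟨f, g, -, -, rfl⟩
  have h1 := (measurable_lintegral (SimpleFunc.measurable_coe_ennreal f)).comp hS
  have h2 := (measurable_lintegral (SimpleFunc.measurable_coe_ennreal g)).comp hT
  exact measurable_expNeg.comp (h1.add h2)

theorem laplaceSystem_generates
    (hgen : mZ ≤ MeasurableSpace.comap S inferInstance ⊔ MeasurableSpace.comap T inferInstance) :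
    mZ ≤ ⨆ e ∈ laplaceSystem S T, MeasurableSpace.comap e inferInstance := by
  refine hgen.trans (sup_le ?_ ?_)
  · exact le_iSup_comap_laplace S fun f hf => ⟨f, 0, hf, by simp, by simp⟩
  · exact le_iSup_comap_laplace T fun f hf => ⟨0, f, by simp, hf, by simp⟩

theorem measure_ext_of_laplace_pair (hS : Measurable S) (hT : Measurable T)
    (hgen : mZ ≤ MeasurableSpace.comap S inferInstance ⊔ MeasurableSpace.comap T inferInstance)
    {P Q : Measure Z} [IsFiniteMeasure P] [IsFiniteMeasure Q]
    (h : ∀ f g : SimpleFunc X ℝ≥0, IsBounded (Function.support f) →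
      IsBounded (Function.support g) →
      ∫⁻ z, expNeg (∫⁻ x, f x ∂(S z).toMeasure + ∫⁻ x, g x ∂(T z).toMeasure) ∂P =
        ∫⁻ z, expNeg (∫⁻ x, f x ∂(S z).toMeasure + ∫⁻ x, g x ∂(T z).toMeasure) ∂Q) : P = Q := by
  refine measure_ext_of_multiplicative laplaceSystem_one laplaceSystem_mul laplaceSystem_le
    (laplaceSystem_measurable hS hT) (laplaceSystem_generates hgen) P Q ?_
  rintro _ ⟨f, g, hf, hg, rfl⟩
  exact h f g hf hg

theorem measure_ext_of_laplace (hT : Measurable T)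
    (hgen : mZ ≤ MeasurableSpace.comap T inferInstance)
    {P Q : Measure Z} [IsFiniteMeasure P] [IsFiniteMeasure Q]
    (h : ∀ f : SimpleFunc X ℝ≥0, IsBounded (Function.support f) →
      ∫⁻ z, expNeg (∫⁻ x, f x ∂(T z).toMeasure) ∂P =
        ∫⁻ z, expNeg (∫⁻ x, f x ∂(T z).toMeasure) ∂Q) : P = Q := by
  -- With both components equal to `T`, the pair `(f, g)` acts only through `f + g`.
  refine measure_ext_of_laplace_pair hT hT (by simpa using hgen) fun f g hf hg => ?_
  simp only [← lintegral_simpleFunc_add]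
  exact h (f + g) (isBounded_support_add hf hg)

theorem measurable_measure_of_laplace (hT : Measurable T)
    (hgen : mZ ≤ MeasurableSpace.comap T inferInstance)
    (K : Y → Measure Z) [∀ y, IsFiniteMeasure (K y)]
    (h : ∀ f : SimpleFunc X ℝ≥0, IsBounded (Function.support f) →
      Measurable fun y => ∫⁻ z, expNeg (∫⁻ x, f x ∂(T z).toMeasure) ∂(K y)) : Measurable K := by
  refine measurable_measure_of_multiplicative (laplaceSystem_one (S := T) (T := T))
    laplaceSystem_mul laplaceSystem_le
    (laplaceSystem_measurable hT hT) (laplaceSystem_generates (by simpa using hgen)) K ?_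
  rintro _ ⟨f, g, hf, hg, rfl⟩
  simp only [← lintegral_simpleFunc_add]
  exact h (f + g) (isBounded_support_add hf hg)

end Pairs

/-- `(n + 1) (1 - e^{-u / (n + 1)}) → u`. -/
theorem tendsto_mul_one_sub_expNeg (u : ℝ≥0∞) :
    Tendsto (fun n : ℕ => ENNReal.ofReal (n + 1) *
      (1 - expNeg (ENNReal.ofReal (1 / (n + 1)) * u))) atTop (𝓝 u) := by
  induction u with
  | top =>
    have h : ∀ n : ℕ, ENNReal.ofReal (n + 1) *
        (1 - expNeg (ENNReal.ofReal (1 / (n + 1)) * ∞)) = ENNReal.ofReal (n + 1) := fun n => by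
      rw [ENNReal.mul_top (by rw [Ne, ENNReal.ofReal_eq_zero, not_le]; positivity)]
      simp
    simp only [h]
    exact ENNReal.tendsto_ofReal_atTop.comp
      (tendsto_atTop_add_const_right _ _ tendsto_natCast_atTop_atTop)
  | coe u =>
    have h : ∀ n : ℕ, ENNReal.ofReal (n + 1) *
        (1 - expNeg (ENNReal.ofReal (1 / (n + 1)) * u)) =
        ENNReal.ofReal ((n + 1) * (1 - Real.exp (-(1 / (n + 1) * u)))) := fun n => by
      rw [← ENNReal.ofReal_coe_nnreal (p := u), ← ENNReal.ofReal_mul (by positivity),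
        expNeg_ofReal (by positivity), ← ENNReal.ofReal_one,
        ← ENNReal.ofReal_sub _ (Real.exp_pos _).le, ← ENNReal.ofReal_mul (by positivity)]
    simp only [h]
    rw [← ENNReal.ofReal_coe_nnreal (p := u)]
    refine ENNReal.tendsto_ofReal ?_
    have hd : HasDerivAt (fun t : ℝ => Real.exp (-(t * u))) (-(u : ℝ)) 0 := by
      have := ((hasDerivAt_id (0 : ℝ)).mul_const (u : ℝ)).neg.exp
      simpa using this
    have h1 := (hasDerivAt_iff_tendsto_slope_zero.1 hd).neg
    have h2 : Tendsto (fun n : ℕ => (1 / (n + 1 : ℝ))) atTop (𝓝[≠] 0) :=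
      tendsto_nhdsWithin_iff.2 ⟨tendsto_one_div_add_atTop_nhds_zero_nat,
        Eventually.of_forall fun n => by
          simp only [Set.mem_compl_iff, Set.mem_singleton_iff]; positivity⟩
    have h3 := h1.comp h2
    rw [neg_neg] at h3
    refine h3.congr fun n => ?_
    simp only [Function.comp_apply, zero_add, one_div, inv_inv, smul_eq_mul, zero_mul, neg_zero,
      Real.exp_zero]
    ring

/-- Differentiation of a Laplace transform: `E[U e^{-V}] = -ψ'(0)` if `E[e^{-(V + t U)}] = ψ(t)` for
`t ≥ 0`. -/
theorem lintegral_mul_expNeg_of_hasDerivAt {Ω : Type*} [MeasurableSpace Ω] (P : Measure Ω)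
    [IsFiniteMeasure P] {U V : Ω → ℝ≥0∞} (hU : Measurable U) (hV : Measurable V)
    {ψ : ℝ → ℝ} {d : ℝ} (hψ : ∀ t, 0 ≤ t → 0 ≤ ψ t)
    (h : ∀ t, 0 ≤ t → ∫⁻ ω, expNeg (V ω + ENNReal.ofReal t * U ω) ∂P = ENNReal.ofReal (ψ t))
    (hd : HasDerivAt ψ (-d) 0) :
    ∫⁻ ω, U ω * expNeg (V ω) ∂P = ENNReal.ofReal d := by
  -- The difference quotients of `t ↦ e^{-(V + t U)}` at `t = 0` with step `1/(n+1)`, with sign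
  -- reversed.
  let g : ℕ → Ω → ℝ≥0∞ := fun n ω => ENNReal.ofReal (n + 1) *
    (1 - expNeg (ENNReal.ofReal (1 / (n + 1)) * U ω)) * expNeg (V ω)
  have hgm : ∀ n, Measurable (g n) := fun n => by fun_prop
  have hlim : ∀ ω, Tendsto (fun n => g n ω) atTop (𝓝 (U ω * expNeg (V ω))) := fun ω =>
    ENNReal.Tendsto.mul_const (tendsto_mul_one_sub_expNeg (U ω)) (Or.inr (expNeg_ne_top _))
  have hgle : ∀ n ω, g n ω ≤ U ω * expNeg (V ω) := fun n ω => by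
    refine mul_le_mul' ?_ le_rfl
    have h1 : ∀ u : ℝ≥0∞, 1 - expNeg u ≤ u := fun u => by
      induction u with
      | top => exact le_top
      | coe u =>
        rw [expNeg_coe, ← ENNReal.ofReal_one, ← ENNReal.ofReal_sub _ (Real.exp_pos _).le,
          ← ENNReal.ofReal_coe_nnreal (p := u)]
        refine ENNReal.ofReal_le_ofReal ?_
        linarith [Real.add_one_le_exp (-(u : ℝ))]
    calc _ ≤ ENNReal.ofReal (n + 1) * (ENNReal.ofReal (1 / (n + 1)) * U ω) :=
          mul_le_mul' le_rfl (h1 _)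
      _ = U ω := by
          rw [← mul_assoc, ← ENNReal.ofReal_mul (by positivity), mul_one_div_cancel (by positivity)]
          simp
  have hgint : ∀ n : ℕ, ∫⁻ ω, g n ω ∂P =
      ENNReal.ofReal ((n + 1) * (ψ 0 - ψ (1 / (n + 1)))) := fun n => by
    have h1 : ∀ ω, g n ω = ENNReal.ofReal (n + 1) *
        (expNeg (V ω) - expNeg (V ω + ENNReal.ofReal (1 / (n + 1)) * U ω)) := fun ω => by
      simp only [g]
      rw [expNeg_add, mul_assoc]
      congr 1
      rw [ENNReal.sub_mul (fun _ _ => expNeg_ne_top _), one_mul, mul_comm (expNeg (V ω))]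
    have hpos : (0 : ℝ) ≤ 1 / (n + 1) := by positivity
    have h0 := h 0 le_rfl
    simp only [ENNReal.ofReal_zero, zero_mul, add_zero] at h0
    simp only [h1]
    rw [lintegral_const_mul _ (by fun_prop), lintegral_sub (by fun_prop), h0, h _ hpos,
      ← ENNReal.ofReal_sub _ (hψ _ hpos), ← ENNReal.ofReal_mul (by positivity)]
    · rw [h _ hpos]; exact ENNReal.ofReal_ne_top
    · exact ae_of_all _ fun ω => expNeg_antitone le_self_add
  have hlim2 : Tendsto (fun n => ∫⁻ ω, g n ω ∂P) atTop (𝓝 (ENNReal.ofReal d)) := by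
    simp only [hgint]
    refine ENNReal.tendsto_ofReal ?_
    have h1 := (hasDerivAt_iff_tendsto_slope_zero.1 hd).neg
    have h2 : Tendsto (fun n : ℕ => (1 / (n + 1 : ℝ))) atTop (𝓝[≠] 0) :=
      tendsto_nhdsWithin_iff.2 ⟨tendsto_one_div_add_atTop_nhds_zero_nat,
        Eventually.of_forall fun n => by
          simp only [Set.mem_compl_iff, Set.mem_singleton_iff]; positivity⟩
    have h3 := h1.comp h2
    rw [neg_neg] at h3
    refine h3.congr fun n => ?_
    simp only [Function.comp_apply, zero_add, one_div, inv_inv, smul_eq_mul]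
    ring
  -- Integrability of `U e^{-V}` is not known beforehand. Fatou gives the upper bound, and the
  -- pointwise bound of the quotients by their limit gives the lower one.
  refine le_antisymm ?_ ?_
  · calc ∫⁻ ω, U ω * expNeg (V ω) ∂P = ∫⁻ ω, liminf (fun n => g n ω) atTop ∂P :=
          lintegral_congr fun ω => (hlim ω).liminf_eq.symm
      _ ≤ liminf (fun n => ∫⁻ ω, g n ω ∂P) atTop := lintegral_liminf_le hgm
      _ = ENNReal.ofReal d := hlim2.liminf_eq
  · exact le_of_tendsto' hlim2 fun n => lintegral_mono (hgle n)

end Laplace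

/-! ### The Poisson random measure on an s-finite space. -/

section PoissonRandomMeasure

open Filter Topology

universe u

theorem lintegral_fin_prod_eq_prod {n : ℕ} {Y : Type*} [MeasurableSpace Y] (Λ : Fin n → Measure Y)
    [∀ i, SigmaFinite (Λ i)] {g : Fin n → Y → ℝ≥0∞} (hg : ∀ i, Measurable (g i)) :
    ∫⁻ x, ∏ i, g i (x i) ∂(Measure.pi Λ) = ∏ i, ∫⁻ y, g i y ∂(Λ i) := by
  induction n with
  | zero => simp
  | succ n ih =>
    rw [← ((measurePreserving_piFinSuccAbove Λ 0).symm).lintegral_comp_emb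
      (MeasurableEquiv.measurableEmbedding _)]
    simp only [MeasurableEquiv.piFinSuccAbove_symm_apply, Fin.insertNthEquiv,
      Fin.prod_univ_succ, Fin.insertNth_zero, Equiv.coe_fn_mk, Fin.cons_succ, Fin.cons_zero,
      Fin.zero_succAbove, cast_eq]
    rw [lintegral_prod_mul (f := g 0) (g := fun x : Fin n → Y => ∏ i : Fin n, g i.succ (x i))
      (hg 0).aemeasurable (Finset.measurable_prod _ fun i _ =>
        (hg i.succ).comp (measurable_pi_apply i)).aemeasurable, ih _ fun i => hg _]

variable {Y : Type u} [MeasurableSpace Y]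

/-- Finite point configurations, listed. -/
abbrev FiniteConfiguration (Y : Type u) : Type u := Σ k : ℕ, (Fin k → Y)

/-- The law of a list of points whose number is Poisson distributed, with `Λ(Y)` as its mean, and
which are independent given their number. -/
noncomputable def finitePoissonLaw (Λ : Measure Y) : Measure (FiniteConfiguration Y) :=
  Measure.sum fun k : ℕ => (ENNReal.ofReal (Real.exp (-(Λ Set.univ).toReal) / k.factorial)) •
    (Measure.pi fun _ : Fin k => Λ).map fun x => ⟨k, x⟩

theorem measurable_sigma_of {Z : Type*} [MeasurableSpace Z] {g : FiniteConfiguration Y → Z}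
    (h : ∀ k, Measurable fun x : Fin k → Y => g ⟨k, x⟩) : Measurable g := fun s hs => by
  change MeasurableSet[⨅ k, MeasurableSpace.map (Sigma.mk k) _] _
  rw [MeasurableSpace.measurableSet_iInf]
  exact fun k => h k hs

theorem measurable_sum_configuration {f : Y → ℝ≥0∞} (hf : Measurable f) :
    Measurable fun ω : FiniteConfiguration Y => ∑ i, f (ω.2 i) :=
  measurable_sigma_of fun k => by
    have : Measurable fun x : Fin k → Y => ∑ i, f (x i) := by fun_prop
    exact this

theorem measurable_sigma_mk (k : ℕ) :
    Measurable (fun x => ⟨k, x⟩ : (Fin k → Y) → FiniteConfiguration Y) := fun s hs => by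
  change MeasurableSet[⨅ k, MeasurableSpace.map (Sigma.mk k) _] _ at hs
  rw [MeasurableSpace.measurableSet_iInf] at hs
  exact hs k

/-- With `a = Λ(e^{-f})`, lists of length `k` contribute `e^{-Λ(Y)} a^k / k!`, as the product
measures are not normalised; the exponential series sums to `e^{-(Λ(Y) - a)}`. The case `f = 0`
shows that the total mass is `1`. -/
theorem lintegral_finitePoissonLaw (Λ : Measure Y) [IsFiniteMeasure Λ] {f : Y → ℝ≥0∞}
    (hf : Measurable f) :
    ∫⁻ ω, expNeg (∑ i, f (ω.2 i)) ∂(finitePoissonLaw Λ) =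
      expNeg (∫⁻ y, (1 - expNeg (f y)) ∂Λ) := by
  have hgm : Measurable fun ω : FiniteConfiguration Y => expNeg (∑ i, f (ω.2 i)) :=
     
    measurable_expNeg.comp (measurable_sum_configuration hf)
  set a : ℝ≥0∞ := ∫⁻ y, expNeg (f y) ∂Λ with ha
  have hale : a ≤ Λ Set.univ := by
    calc a ≤ ∫⁻ _, 1 ∂Λ := lintegral_mono fun y => expNeg_le_one _
      _ = Λ Set.univ := by simp
  have hatop : a ≠ ∞ := (hale.trans_lt (measure_lt_top _ _)).ne
  have hk : ∀ k : ℕ, ∫⁻ x : Fin k → Y, expNeg (∑ i, f (x i)) ∂(Measure.pi fun _ : Fin k => Λ) =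
      a ^ k := fun k => by
    simp only [expNeg_sum]
    rw [lintegral_fin_prod_eq_prod (fun _ => Λ) (g := fun _ y => expNeg (f y))
      (fun _ => by fun_prop)]
    simp [ha]
  rw [finitePoissonLaw, lintegral_sum_measure]
  simp only [lintegral_smul_measure, lintegral_map hgm (measurable_sigma_mk _), hk]
  rw [lintegral_sub (by fun_prop) hatop (ae_of_all _ fun y => expNeg_le_one _)]
  simp only [lintegral_one, ← ha]
  have hsub : Λ Set.univ - a = ENNReal.ofReal ((Λ Set.univ).toReal - a.toReal) := by
    rw [ENNReal.ofReal_sub _ ENNReal.toReal_nonneg, ENNReal.ofReal_toReal hatop,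
      ENNReal.ofReal_toReal (measure_ne_top _ _)]
  rw [hsub, expNeg_ofReal (sub_nonneg.2 (ENNReal.toReal_mono (measure_ne_top _ _) hale))]
  have hterm : ∀ k : ℕ, ENNReal.ofReal (Real.exp (-(Λ Set.univ).toReal) / k.factorial) • a ^ k =
      ENNReal.ofReal (Real.exp (-(Λ Set.univ).toReal) * (a.toReal ^ k / k.factorial)) := fun k => by
    rw [smul_eq_mul, ← ENNReal.ofReal_toReal hatop, ← ENNReal.ofReal_pow ENNReal.toReal_nonneg,
      ← ENNReal.ofReal_mul (by positivity), ENNReal.toReal_ofReal ENNReal.toReal_nonneg]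
    congr 1; ring
  simp only [hterm]
  have hsum := (NormedSpace.expSeries_div_hasSum_exp a.toReal).mul_left
    (Real.exp (-(Λ Set.univ).toReal))
  rw [← Real.exp_eq_exp_ℝ] at hsum
  rw [← ENNReal.ofReal_tsum_of_nonneg (fun k => by positivity) hsum.summable, hsum.tsum_eq,
    ← Real.exp_add]
  congr 2; ring

instance (Λ : Measure Y) [IsFiniteMeasure Λ] : IsProbabilityMeasure (finitePoissonLaw Λ) := by
  have := lintegral_finitePoissonLaw Λ (measurable_zero (β := Y) (α := ℝ≥0∞))
  exact ⟨by simpa using this⟩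

/-- The random measure with a unit mass at each point of each of a sequence of lists. -/
noncomputable def countingMeasure (ω : ℕ → FiniteConfiguration Y) : Measure Y :=
  Measure.sum fun n => ∑ i, Measure.dirac ((ω n).2 i)

theorem lintegral_countingMeasure (ω : ℕ → FiniteConfiguration Y) {f : Y → ℝ≥0∞}
    (hf : Measurable f) : ∫⁻ y, f y ∂(countingMeasure ω) = ∑' n, ∑ i, f ((ω n).2 i) := by
  simp [countingMeasure, lintegral_sum_measure, lintegral_finsetSum_measure, lintegral_dirac' _ hf]

theorem measurable_countingMeasure :
    Measurable (countingMeasure : (ℕ → FiniteConfiguration Y) → Measure Y) := by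
  refine Measure.measurable_of_measurable_coe _ fun A hA => ?_
  have hm : Measurable (A.indicator (1 : Y → ℝ≥0∞)) := measurable_one.indicator hA
  simp only [← lintegral_indicator_one hA, lintegral_countingMeasure _ hm]
  have h2 : Measurable fun ω : FiniteConfiguration Y => ∑ i, A.indicator (1 : Y → ℝ≥0∞) (ω.2 i) :=
    measurable_sum_configuration hm
  exact Measurable.tsum fun n => h2.comp (measurable_pi_apply n)

theorem exists_countingMeasure_eq_natCast (ω : ℕ → FiniteConfiguration Y) {A : Set Y}
    (hA : MeasurableSet A) (h : countingMeasure ω A ≠ ∞) : ∃ n : ℕ, countingMeasure ω A = n := by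
  classical
  rw [← lintegral_indicator_one hA,
    lintegral_countingMeasure _ (measurable_one.indicator hA)] at h ⊢
  let I := Σ n : ℕ, Fin (ω n).1
  -- Positions in the lists, not points of `Y`, so that repeated points are counted with
  -- multiplicity. The mass of `A` is the cardinality of this set.
  let B : Set I := {p | (ω p.1).2 p.2 ∈ A}
  have h1 : ∑' n, ∑ i, A.indicator (1 : Y → ℝ≥0∞) ((ω n).2 i) = (B.encard : ℝ≥0∞) := by
    rw [← ENNReal.tsum_set_one, tsum_subtype B (fun _ => (1 : ℝ≥0∞)), ENNReal.tsum_sigma']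
    refine tsum_congr fun n => ?_
    rw [tsum_fintype]
    refine Finset.sum_congr rfl fun i _ => ?_
    by_cases hi : (ω n).2 i ∈ A <;> simp [Set.indicator, B, hi]
  rw [h1] at h ⊢
  have h2 : B.encard ≠ ⊤ := by simpa using h
  obtain ⟨n, hn⟩ := ENat.ne_top_iff_exists.1 h2
  exact ⟨n, by rw [← hn]; simp⟩

/-- The Poisson random measure: existence of a random measure taking integer or infinite values
whose Laplace transform is that of the Poisson process with intensity `Λ`. -/
theorem exists_poissonRandomMeasure (Λ : Measure Y) [SFinite Λ] :
    ∃ P : Measure (ℕ → FiniteConfiguration Y), IsProbabilityMeasure P ∧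
      ∀ f : Y → ℝ≥0∞, Measurable f → ∫⁻ ω, expNeg (∫⁻ y, f y ∂(countingMeasure ω)) ∂P =
        expNeg (∫⁻ y, (1 - expNeg (f y)) ∂Λ) := by
  -- Superposition: `Λ` is a sum of finite measures, and independent finite Poisson configurations
  -- for the summands are put together. The transforms multiply, and a passage to the limit covers
  -- the infinite sum.
  let Q : ℕ → Measure (FiniteConfiguration Y) := fun n => finitePoissonLaw (sfiniteSeq Λ n)
  refine ⟨Measure.infinitePi Q, inferInstance, fun f hf => ?_⟩
  let g : FiniteConfiguration Y → ℝ≥0∞ := fun ω => ∑ i, f (ω.2 i)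
  have hg : Measurable g := measurable_sum_configuration hf
  simp only [lintegral_countingMeasure _ hf]
  have hfin : ∀ m : ℕ, ∫⁻ ω, expNeg (∑ n ∈ Finset.range m, g (ω n)) ∂(Measure.infinitePi Q) =
      expNeg (∑ n ∈ Finset.range m, ∫⁻ y, (1 - expNeg (f y)) ∂(sfiniteSeq Λ n)) := fun m => by
    simp only [expNeg_sum]
    have hind : iIndepFun (fun n (ω : ℕ → FiniteConfiguration Y) => expNeg (g (ω n)))
        (Measure.infinitePi Q) :=
      iIndepFun_infinitePi (X := fun _ ω => expNeg (g ω)) (fun n => by fun_prop)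
    rw [lintegral_prod_eq_prod_lintegral_of_indepFun _ _ hind (fun n => by fun_prop)]
    refine Finset.prod_congr rfl fun n _ => ?_
    rw [← lintegral_finitePoissonLaw _ hf]
    change _ = ∫⁻ ω, expNeg (g ω) ∂(Q n)
    rw [← Measure.infinitePi_map_eval Q n, lintegral_map (by fun_prop) (measurable_pi_apply n)]
  have hlim : Tendsto (fun m => ∫⁻ ω, expNeg (∑ n ∈ Finset.range m, g (ω n))
      ∂(Measure.infinitePi Q)) atTop
      (𝓝 (∫⁻ ω, expNeg (∑' n, g (ω n)) ∂(Measure.infinitePi Q))) := by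
    refine tendsto_lintegral_of_dominated_convergence (fun _ => 1) (fun m => by fun_prop)
      (fun m => ae_of_all _ fun ω => expNeg_le_one _) (by simp) (ae_of_all _ fun ω => ?_)
    exact (continuous_expNeg.tendsto _).comp (ENNReal.tendsto_nat_tsum _)
  have hlim2 : Tendsto (fun m => ∫⁻ ω, expNeg (∑ n ∈ Finset.range m, g (ω n))
      ∂(Measure.infinitePi Q)) atTop (𝓝 (expNeg (∫⁻ y, (1 - expNeg (f y)) ∂Λ))) := by
    simp only [hfin]
    have : ∫⁻ y, (1 - expNeg (f y)) ∂Λ =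
        ∑' n, ∫⁻ y, (1 - expNeg (f y)) ∂(sfiniteSeq Λ n) := by
      conv_lhs => rw [← sum_sfiniteSeq Λ, lintegral_sum_measure]
    rw [this]
    exact (continuous_expNeg.tendsto _).comp (ENNReal.tendsto_nat_tsum _)
  exact tendsto_nhds_unique hlim hlim2

end PoissonRandomMeasure

/-! ### Existence and uniqueness of the Poisson process. -/

section PoissonProcess

open Filter Topology LocallyFiniteMeasure

variable {X : Type*} [MetricSpace X] [MeasurableSpace X]

namespace LocallyFiniteMeasure

open Classical in
/-- A measure as a locally finite measure, with the value `0` where it is not locally finite. -/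
noncomputable def ofMeasure (m : Measure X) : LocallyFiniteMeasure X :=
  if h : ∀ A : Set X, MeasurableSet A → IsBounded A → m A < ∞ then ⟨m, h⟩
  else ⟨0, fun A _ _ => by simp⟩

theorem toMeasure_ofMeasure {m : Measure X}
    (h : ∀ A : Set X, MeasurableSet A → IsBounded A → m A < ∞) : (ofMeasure m).toMeasure = m := by
  have e : ofMeasure m = (⟨m, h⟩ : LocallyFiniteMeasure X) := dif_pos h
  rw [e]; rfl

theorem toMeasure_ofMeasure_of_not {m : Measure X}
    (h : ¬ ∀ A : Set X, MeasurableSet A → IsBounded A → m A < ∞) : (ofMeasure m).toMeasure = 0 := by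
  have e : ofMeasure m = (⟨0, fun A _ _ => by simp⟩ : LocallyFiniteMeasure X) := dif_neg h
  rw [e]; rfl

theorem apply_lt_top (κ : LocallyFiniteMeasure X) {A : Set X} (hA : MeasurableSet A)
    (hb : IsBounded A) : κ.toMeasure A < ∞ := κ.2 A hA hb

theorem toMeasure_ofMeasure_eq_or (m : Measure X) :
    (ofMeasure m).toMeasure = m ∨ (ofMeasure m).toMeasure = 0 := by
  by_cases h : ∀ A : Set X, MeasurableSet A → IsBounded A → m A < ∞
  · exact Or.inl (toMeasure_ofMeasure h)
  · exact Or.inr (toMeasure_ofMeasure_of_not h)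

theorem forall_bounded_lt_top_iff [BorelSpace X] (x₀ : X) (m : Measure X) :
    (∀ A : Set X, MeasurableSet A → IsBounded A → m A < ∞) ↔
      ∀ n : ℕ, m (Metric.closedBall x₀ n) < ∞ := by
  refine ⟨fun h n => h _ Metric.isClosed_closedBall.measurableSet Metric.isBounded_closedBall,
    fun h A _ hb => ?_⟩
  obtain ⟨r, hr⟩ := hb.subset_closedBall x₀
  obtain ⟨n, hn⟩ := exists_nat_ge r
  exact (measure_mono (hr.trans (Metric.closedBall_subset_closedBall hn))).trans_lt (h n)

/-- Local finiteness need only be tested on the balls of integer radius about one point, so it is a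
measurable event. -/
theorem measurable_ofMeasure [BorelSpace X] :
    Measurable (ofMeasure : Measure X → LocallyFiniteMeasure X) := by
  classical
  rcases isEmpty_or_nonempty X with hX | ⟨⟨x₀⟩⟩
  · have : ∀ m m' : Measure X, m = m' := fun m m' => by
      rw [Measure.eq_zero_of_isEmpty m, Measure.eq_zero_of_isEmpty m']
    exact measurable_const' fun m m' => by rw [this m m']
  refine measurable_of_eval fun A hA hb => ?_
  have hG : MeasurableSet {m : Measure X | ∀ n : ℕ, m (Metric.closedBall x₀ n) < ∞} := by
    rw [Set.ofPred_forall]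
    exact MeasurableSet.iInter fun n => measurableSet_lt
      (Measure.measurable_coe Metric.isClosed_closedBall.measurableSet) measurable_const
  have : (fun m : Measure X => (ofMeasure m).toMeasure A) =
      fun m => if m ∈ {m : Measure X | ∀ n : ℕ, m (Metric.closedBall x₀ n) < ∞} then m A else 0 := by
    ext m
    by_cases h : ∀ A : Set X, MeasurableSet A → IsBounded A → m A < ∞
    · rw [toMeasure_ofMeasure h]
      exact (if_pos ((forall_bounded_lt_top_iff x₀ m).1 h)).symm
    · rw [toMeasure_ofMeasure_of_not h]
      exact (if_neg fun h' => h ((forall_bounded_lt_top_iff x₀ m).2 h')).symm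
  rw [this]
  exact Measurable.ite hG (Measure.measurable_coe hA) measurable_const

/-- Finite mean on bounded sets makes a random measure locally finite almost surely, so the default
value in `ofMeasure` leaves its law unaffected. -/
theorem ae_toMeasure_ofMeasure [BorelSpace X] {Ω : Type*} [MeasurableSpace Ω] {P : Measure Ω}
    {N : Ω → Measure X} (hN : Measurable N)
    (h : ∀ A : Set X, MeasurableSet A → IsBounded A → ∫⁻ ω, N ω A ∂P ≠ ∞) :
    ∀ᵐ ω ∂P, (ofMeasure (N ω)).toMeasure = N ω := by
  rcases isEmpty_or_nonempty X with hX | ⟨⟨x₀⟩⟩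
  · exact ae_of_all _ fun ω => by
      rw [Measure.eq_zero_of_isEmpty (N ω), Measure.eq_zero_of_isEmpty (ofMeasure 0).toMeasure]
  have : ∀ n : ℕ, ∀ᵐ ω ∂P, N ω (Metric.closedBall x₀ n) < ∞ := fun n =>
    ae_lt_top ((Measure.measurable_coe Metric.isClosed_closedBall.measurableSet).comp hN)
      (h _ Metric.isClosed_closedBall.measurableSet Metric.isBounded_closedBall)
  filter_upwards [ae_all_iff.2 this] with ω hω
  exact toMeasure_ofMeasure ((forall_bounded_lt_top_iff x₀ _).2 hω)

end LocallyFiniteMeasure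

namespace PointMeasure

@[fun_prop]
theorem measurable_toLocallyFinite :
    Measurable (toLocallyFinite : PointMeasure X → LocallyFiniteMeasure X) :=
  comap_measurable _

@[fun_prop]
theorem measurable_toMeasure [BorelSpace X] :
    Measurable (toMeasure : PointMeasure X → Measure X) :=
  LocallyFiniteMeasure.measurable_toMeasure.comp measurable_toLocallyFinite

@[fun_prop]
theorem measurable_lintegral [BorelSpace X] {f : X → ℝ≥0∞} (hf : Measurable f) :
    Measurable fun μ : PointMeasure X => ∫⁻ x, f x ∂μ.toMeasure :=
  (Measure.measurable_lintegral hf).comp measurable_toMeasure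

theorem measurable_apply [BorelSpace X] {A : Set X} (hA : MeasurableSet A) :
    Measurable fun μ : PointMeasure X => μ.toMeasure A :=
  (Measure.measurable_coe hA).comp measurable_toMeasure

theorem measurable_of_toLocallyFinite {Ω : Type*} [MeasurableSpace Ω] {φ : Ω → PointMeasure X}
    (h : Measurable fun ω => (φ ω).toLocallyFinite) : Measurable φ :=
  measurable_comap_iff.2 h

end PointMeasure

/-- Laplace transform of a Poisson random variable. -/
theorem lintegral_expNeg_poissonMeasure (r t : ℝ≥0) :
    ∫⁻ n : ℕ, expNeg (t * n) ∂(poissonMeasure r) = expNeg ((1 - expNeg t) * r) := by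
  have h1 : (1 - expNeg t) * r = ENNReal.ofReal ((1 - Real.exp (-t)) * r) := by
    rw [expNeg_coe, ← ENNReal.ofReal_one, ← ENNReal.ofReal_sub _ (Real.exp_pos _).le,
      ENNReal.ofReal_mul (by simp), ENNReal.ofReal_coe_nnreal]
  have h2 : Real.exp (-t) ≤ 1 := by simp
  rw [h1, expNeg_ofReal (mul_nonneg (by linarith) r.coe_nonneg), lintegral_countable']
  have hterm : ∀ n : ℕ, expNeg (t * n) * poissonMeasure r {n} =
      ENNReal.ofReal (Real.exp (-r) * ((r * Real.exp (-t)) ^ n / n.factorial)) := fun n => by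
    have : (t : ℝ≥0∞) * n = ((t * n : ℝ≥0) : ℝ≥0∞) := by push_cast; rfl
    rw [poissonMeasure_singleton, this, expNeg_coe, ← ENNReal.ofReal_mul (Real.exp_pos _).le]
    congr 1
    rw [mul_pow, ← Real.exp_nat_mul]
    push_cast
    rw [show -((t : ℝ) * n) = n * -(t : ℝ) by ring]
    ring
  simp only [hterm]
  have hsum := (NormedSpace.expSeries_div_hasSum_exp ((r : ℝ) * Real.exp (-t))).mul_left
    (Real.exp (-r))
  rw [← Real.exp_eq_exp_ℝ] at hsum
  rw [← ENNReal.ofReal_tsum_of_nonneg (fun k => by positivity) hsum.summable, hsum.tsum_eq,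
    ← Real.exp_add]
  congr 2; ring

/-- The integral of a function of a simple function of bounded support as a finite sum. -/
theorem exists_lintegral_simpleFunc_eq_sum (f : SimpleFunc X ℝ≥0)
    (hf : IsBounded (Function.support f)) :
    ∃ (n : ℕ) (A : Fin n → Set X) (v : Fin n → ℝ≥0), (∀ i, MeasurableSet (A i)) ∧
      (∀ i, IsBounded (A i)) ∧ (∀ i j, i ≠ j → Disjoint (A i) (A j)) ∧
      ∀ (φ : ℝ≥0 → ℝ≥0∞), φ 0 = 0 → ∀ μ : Measure X,
        ∫⁻ x, φ (f x) ∂μ = ∑ i, φ (v i) * μ (A i) := by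
  classical
  -- The value `0` is left out: the other fibres lie in the support, hence are bounded, and `φ 0 =
  -- 0` removes the contribution of the omitted one.
  let s := f.range.filter (· ≠ 0)
  let e := s.equivFin.symm
  refine ⟨s.card, fun i => f ⁻¹' {(e i : ℝ≥0)}, fun i => (e i : ℝ≥0), fun i => f.measurableSet_fiber _,
    fun i => hf.subset fun x hx => ?_, fun i j hij => ?_, fun φ hφ μ => ?_⟩
  · have h1 : (e i : ℝ≥0) ≠ 0 := (Finset.mem_filter.1 (e i).2).2
    have h2 : f x = e i := hx
    rw [Function.mem_support, h2]; exact h1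
  · refine Set.disjoint_left.2 fun x hx hx' => hij ?_
    have h1 : f x = e i := hx
    have h2 : f x = e j := hx'
    exact e.injective (Subtype.ext (h1.symm.trans h2))
  · have h1 : ∫⁻ x, φ (f x) ∂μ = ∑ y ∈ f.range, φ y * μ (f ⁻¹' {y}) := by
      have : (fun x => φ (f x)) = (f.map φ : X → ℝ≥0∞) := by ext; simp
      rw [this, SimpleFunc.lintegral_eq_lintegral, SimpleFunc.map_lintegral]
    rw [h1, Equiv.sum_comp e (fun y : s => φ (y : ℝ≥0) * μ (f ⁻¹' {(y : ℝ≥0)})),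
      Finset.sum_coe_sort s (fun y => φ y * μ (f ⁻¹' {y}))]
    symm
    refine Finset.sum_filter_of_ne fun y _ hy h0 => hy ?_
    rw [h0, hφ, zero_mul]

/-- `P` has the Laplace transform of a Poisson process with intensity `κ`. -/
def HasPoissonLaplace {Ω : Type*} [MeasurableSpace Ω] (κ : Measure X) (P : Measure Ω)
    (N : Ω → Measure X) : Prop :=
  ∀ f : X → ℝ≥0∞, Measurable f →
    ∫⁻ ω, expNeg (∫⁻ x, f x ∂(N ω)) ∂P = expNeg (∫⁻ x, (1 - expNeg (f x)) ∂κ)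

/-- `E[N(A) e^{-N(f)}] = ∫_A e^{-f} dκ · exp (-∫ (1 - e^{-f}) dκ)` for a Poisson process. -/
theorem HasPoissonLaplace.lintegral_mul_expNeg {Ω : Type*} [MeasurableSpace Ω] {κ : Measure X}
    {P : Measure Ω} [IsFiniteMeasure P] {N : Ω → Measure X} (h : HasPoissonLaplace κ P N)
    (hN : Measurable N) {A : Set X} (hA : MeasurableSet A) (hAκ : κ A ≠ ∞) {f : X → ℝ≥0∞}
    (hf : Measurable f) (hfκ : ∫⁻ x, (1 - expNeg (f x)) ∂κ ≠ ∞) :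
    ∫⁻ ω, N ω A * expNeg (∫⁻ x, f x ∂(N ω)) ∂P =
      (∫⁻ x in A, expNeg (f x) ∂κ) * expNeg (∫⁻ x, (1 - expNeg (f x)) ∂κ) := by
  set a : ℝ≥0∞ := ∫⁻ x in A, expNeg (f x) ∂κ with ha
  set c : ℝ≥0∞ := ∫⁻ x in Aᶜ, (1 - expNeg (f x)) ∂κ with hc
  have hale : a ≤ κ A := by
    calc a ≤ ∫⁻ x in A, 1 ∂κ := lintegral_mono fun y => expNeg_le_one _
      _ = κ A := by simp
  have hatop : a ≠ ∞ := (hale.trans_lt hAκ.lt_top).ne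
  have hctop : c ≠ ∞ := ((setLIntegral_le_lintegral _ _).trans_lt hfκ.lt_top).ne
  have hacA : a.toReal ≤ (κ A).toReal := ENNReal.toReal_mono hAκ hale
  -- The Laplace transform at `f + t 1_A`: only the part of the exponent over `A` depends on `t`,
  -- and `ψ'(0) = -a ψ(0)`.
  let ψ : ℝ → ℝ := fun t => Real.exp (-((κ A).toReal - Real.exp (-t) * a.toReal + c.toReal))
  have hlap : ∀ t : ℝ, 0 ≤ t →
      ∫⁻ x, (1 - expNeg (f x + ENNReal.ofReal t * A.indicator 1 x)) ∂κ =
        ENNReal.ofReal ((κ A).toReal - Real.exp (-t) * a.toReal + c.toReal) := by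
    intro t ht
    have hexp : Real.exp (-t) ≤ 1 := by simpa using ht
    rw [← lintegral_add_compl _ hA]
    have h1 : ∫⁻ x in A, (1 - expNeg (f x + ENNReal.ofReal t * A.indicator 1 x)) ∂κ =
        ENNReal.ofReal ((κ A).toReal - Real.exp (-t) * a.toReal) := by
      have : ∫⁻ x in A, (1 - expNeg (f x + ENNReal.ofReal t * A.indicator 1 x)) ∂κ =
          ∫⁻ x in A, (1 - ENNReal.ofReal (Real.exp (-t)) * expNeg (f x)) ∂κ := by
        refine setLIntegral_congr_fun hA fun x hx => ?_
        simp only [Set.indicator_of_mem hx, Pi.one_apply, mul_one]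
        rw [expNeg_add, expNeg_ofReal ht, mul_comm]
      rw [this, lintegral_sub (by fun_prop), lintegral_const_mul _ (by fun_prop), ← ha,
        ENNReal.ofReal_sub _ (by positivity), ENNReal.ofReal_mul (Real.exp_pos _).le,
        ENNReal.ofReal_toReal hatop, ENNReal.ofReal_toReal hAκ]
      · simp
      · rw [lintegral_const_mul _ (by fun_prop), ← ha]
        exact ENNReal.mul_ne_top ENNReal.ofReal_ne_top hatop
      · refine ae_of_all _ fun x => ?_
        calc _ ≤ (1 : ℝ≥0∞) * 1 := mul_le_mul' (ENNReal.ofReal_le_one.2 hexp) (expNeg_le_one _)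
          _ = 1 := by simp
    have h2 : ∫⁻ x in Aᶜ, (1 - expNeg (f x + ENNReal.ofReal t * A.indicator 1 x)) ∂κ = c := by
      refine setLIntegral_congr_fun hA.compl fun x hx => ?_
      simp only [Set.indicator_of_notMem (show x ∉ A from hx), mul_zero, add_zero]
    have h3 : 0 ≤ (κ A).toReal - Real.exp (-t) * a.toReal := by
      have : Real.exp (-t) * a.toReal ≤ 1 * a.toReal :=
        mul_le_mul_of_nonneg_right hexp ENNReal.toReal_nonneg
      linarith
    rw [h1, h2, ENNReal.ofReal_add h3 ENNReal.toReal_nonneg, ENNReal.ofReal_toReal hctop]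
  have hnonneg : ∀ t : ℝ, 0 ≤ t → 0 ≤ (κ A).toReal - Real.exp (-t) * a.toReal + c.toReal := by
    intro t ht
    have hexp : Real.exp (-t) ≤ 1 := by simpa using ht
    have : Real.exp (-t) * a.toReal ≤ 1 * a.toReal :=
      mul_le_mul_of_nonneg_right hexp ENNReal.toReal_nonneg
    have := ENNReal.toReal_nonneg (a := c)
    linarith
  have hind : Measurable (A.indicator (1 : X → ℝ≥0∞)) := measurable_one.indicator hA
  have hmain : ∀ t, 0 ≤ t → ∫⁻ ω, expNeg (∫⁻ x, f x ∂(N ω) + ENNReal.ofReal t * N ω A) ∂P =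
      ENNReal.ofReal (ψ t) := by
    intro t ht
    have h1 : ∀ ω, ∫⁻ x, f x ∂(N ω) + ENNReal.ofReal t * N ω A =
        ∫⁻ x, (f x + ENNReal.ofReal t * A.indicator 1 x) ∂(N ω) := fun ω => by
      rw [lintegral_add_left hf, lintegral_const_mul _ hind, lintegral_indicator_one hA]
    simp only [h1]
    rw [h (fun x => f x + ENNReal.ofReal t * A.indicator 1 x) (hf.add (hind.const_mul _)), hlap t ht, expNeg_ofReal (hnonneg t ht)]
  have hd : HasDerivAt ψ (-(a.toReal * ψ 0)) 0 := by
    have h1 : HasDerivAt (fun t : ℝ => Real.exp (-t)) (-1) 0 := by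
      simpa using (hasDerivAt_id (0 : ℝ)).neg.exp
    have h2 := ((((h1.mul_const a.toReal).const_sub (κ A).toReal).add_const c.toReal).neg).exp
    exact h2.congr_deriv (by simp [ψ]; ring)
  have hψ0 : expNeg (∫⁻ x, (1 - expNeg (f x)) ∂κ) = ENNReal.ofReal (ψ 0) := by
    have := hlap 0 le_rfl
    simp only [ENNReal.ofReal_zero, zero_mul, add_zero] at this
    rw [this, expNeg_ofReal (hnonneg 0 le_rfl)]
  rw [hψ0, ← ENNReal.ofReal_toReal hatop, ← ENNReal.ofReal_mul ENNReal.toReal_nonneg]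
  exact lintegral_mul_expNeg_of_hasDerivAt P ((Measure.measurable_coe hA).comp hN)
    ((Measure.measurable_lintegral hf).comp hN) (fun t _ => (Real.exp_pos _).le) hmain hd

variable [BorelSpace X]

theorem exists_hasPoissonLaplace (κ : LocallyFiniteMeasure X) :
    ∃ P : Measure (PointMeasure X), IsProbabilityMeasure P ∧
      HasPoissonLaplace κ.toMeasure P PointMeasure.toMeasure := by
  obtain ⟨Q, hQ, hL⟩ := exists_poissonRandomMeasure κ.toMeasure
  have hL' : HasPoissonLaplace κ.toMeasure Q countingMeasure := hL
  let φ : (ℕ → FiniteConfiguration X) → PointMeasure X := fun ω =>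
    ⟨ofMeasure (countingMeasure ω), fun A hA hb => by
      have hfin := (ofMeasure (countingMeasure ω)).2 A hA hb
      rcases toMeasure_ofMeasure_eq_or (countingMeasure ω) with h | h
      · rw [h]
        refine exists_countingMeasure_eq_natCast ω hA ?_
        rw [← h]; exact hfin.ne
      · exact ⟨0, by rw [h]; simp⟩⟩
  have hφ : Measurable φ := PointMeasure.measurable_of_toLocallyFinite
    (measurable_ofMeasure.comp measurable_countingMeasure)
  have hae : ∀ᵐ ω ∂Q, (ofMeasure (countingMeasure ω)).toMeasure = countingMeasure ω := by
    refine ae_toMeasure_ofMeasure measurable_countingMeasure fun A hA hb => ?_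
    -- The case `f = 0` is the first moment `E[N(A)] = κ(A)`.
    have := hL'.lintegral_mul_expNeg measurable_countingMeasure hA (κ.apply_lt_top hA hb).ne
      (f := fun _ => 0) measurable_const (by simp)
    simp only [lintegral_zero, expNeg_zero, mul_one] at this
    rw [this]
    simpa using (κ.apply_lt_top hA hb).ne
  refine ⟨Q.map φ, Measure.isProbabilityMeasure_map hφ.aemeasurable, fun f hf => ?_⟩
  rw [lintegral_map (by fun_prop) hφ, ← hL f hf]
  refine lintegral_congr_ae ?_
  filter_upwards [hae] with ω hω
  change expNeg (∫⁻ x, f x ∂(ofMeasure (countingMeasure ω)).toMeasure) = _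
  rw [hω]

theorem lintegral_sum_indicator {n : ℕ} {A : Fin n → Set X} (hA : ∀ i, MeasurableSet (A i))
    (t : Fin n → ℝ≥0∞) (μ : Measure X) :
    ∫⁻ x, ∑ i, t i * (A i).indicator 1 x ∂μ = ∑ i, t i * μ (A i) := by
  have hm : ∀ i, Measurable ((A i).indicator (1 : X → ℝ≥0∞)) := fun i =>
    measurable_one.indicator (hA i)
  rw [lintegral_finsetSum _ fun i _ => (hm i).const_mul _]
  refine Finset.sum_congr rfl fun i _ => ?_
  rw [lintegral_const_mul _ (hm i), lintegral_indicator_one (hA i)]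

/-- At most one summand is nonzero at `x`, and `1 - e^{-t}` vanishes at `t = 0`. -/
theorem one_sub_expNeg_sum_indicator {n : ℕ} {A : Fin n → Set X}
    (hd : ∀ i j, i ≠ j → Disjoint (A i) (A j)) (t : Fin n → ℝ≥0∞) (x : X) :
    1 - expNeg (∑ i, t i * (A i).indicator 1 x) =
      ∑ i, (1 - expNeg (t i)) * (A i).indicator 1 x := by
  by_cases hx : ∃ j, x ∈ A j
  · obtain ⟨j, hj⟩ := hx
    have hne : ∀ i, i ≠ j → x ∉ A i := fun i hij hi => Set.disjoint_left.1 (hd i j hij) hi hj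
    rw [Finset.sum_eq_single j (fun i _ hij => by simp [hne i hij]) (by simp),
      Finset.sum_eq_single j (fun i _ hij => by simp [hne i hij]) (by simp)]
    simp [hj]
  · push Not at hx
    simp [hx]

/-- On combinations of indicators of disjoint sets the transform is a product of Poisson transforms;
uniqueness of finite-dimensional transforms yields the marginals and the independence. -/
theorem HasPoissonLaplace.isPoissonProcess {κ : LocallyFiniteMeasure X}
    {P : Measure (PointMeasure X)} [IsProbabilityMeasure P]
    (h : HasPoissonLaplace κ.toMeasure P PointMeasure.toMeasure) : IsPoissonProcess κ P := by
  have hfd : ∀ (n : ℕ) (A : Fin n → Set X), (∀ i, MeasurableSet (A i)) →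
      (∀ i j, i ≠ j → Disjoint (A i) (A j)) → ∀ t : Fin n → ℝ≥0,
      ∫⁻ μ, expNeg (∑ i, t i * μ.toMeasure (A i)) ∂P =
        expNeg (∑ i, (1 - expNeg (t i)) * κ.toMeasure (A i)) := by
    intro n A hA hd t
    have := h (fun x => ∑ i, t i * (A i).indicator 1 x)
      (Finset.measurable_sum _ fun i _ => (measurable_one.indicator (hA i)).const_mul _)
    simp only [one_sub_expNeg_sum_indicator hd] at this
    rwa [lintegral_sum_indicator hA, funext fun μ : PointMeasure X =>
      congrArg expNeg (lintegral_sum_indicator hA (fun i => (t i : ℝ≥0∞)) μ.toMeasure)] at this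
  have hone : ∀ A : Set X, MeasurableSet A → ∀ t : ℝ≥0,
      ∫⁻ μ, expNeg (t * μ.toMeasure A) ∂P = expNeg ((1 - expNeg t) * κ.toMeasure A) := by
    intro A hA t
    simpa using hfd 1 (fun _ => A) (fun _ => hA) (fun i j hij => (hij (Subsingleton.elim i j)).elim)
      (fun _ => t)
  refine ⟨inferInstance, fun A hA hb => ?_, fun n A hA hb hd => ?_⟩
  · have hm := PointMeasure.measurable_apply hA
    have := Measure.isProbabilityMeasure_map (μ := P) hm.aemeasurable
    have hc : Measurable fun n : ℕ => (n : ℝ≥0∞) := measurable_of_countable _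
    have := Measure.isProbabilityMeasure_map (μ := poissonMeasure (κ.toMeasure A).toNNReal)
      hc.aemeasurable
    refine measure_ennreal_ext_of_laplace fun t => ?_
    rw [lintegral_map (by fun_prop) hm, lintegral_map (by fun_prop) hc, hone A hA,
      lintegral_expNeg_poissonMeasure, ENNReal.coe_toNNReal (κ.apply_lt_top hA hb).ne]
  · have hm : ∀ i, Measurable fun μ : PointMeasure X => μ.toMeasure (A i) := fun i =>
      PointMeasure.measurable_apply (hA i)
    rw [iIndepFun_iff_map_fun_eq_pi_map fun i => (hm i).aemeasurable]
    have := Measure.isProbabilityMeasure_map (μ := P) (measurable_pi_iff.2 hm).aemeasurable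
    have := fun i => Measure.isProbabilityMeasure_map (μ := P) (hm i).aemeasurable
    refine measure_pi_ext_of_laplace fun t => ?_
    rw [lintegral_map (by fun_prop) (measurable_pi_iff.2 hm), hfd n A hA hd]
    simp only [expNeg_sum]
    rw [lintegral_fin_prod_eq_prod _ (g := fun i x => expNeg (t i * x)) (fun i => by fun_prop)]
    refine Finset.prod_congr rfl fun i _ => ?_
    rw [lintegral_map (by fun_prop) (hm i), hone _ (hA i)]

theorem IsPoissonProcess.lintegral_expNeg_simpleFunc {κ : LocallyFiniteMeasure X}
    {P : Measure (PointMeasure X)} (h : IsPoissonProcess κ P) (f : SimpleFunc X ℝ≥0)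
    (hf : IsBounded (Function.support f)) :
    ∫⁻ μ, expNeg (∫⁻ x, f x ∂μ.toMeasure) ∂P =
      expNeg (∫⁻ x, (1 - expNeg (f x)) ∂κ.toMeasure) := by
  obtain ⟨n, A, v, hA, hb, hd, hsum⟩ := exists_lintegral_simpleFunc_eq_sum f hf
  have hm : ∀ i, Measurable fun μ : PointMeasure X => μ.toMeasure (A i) := fun i =>
    PointMeasure.measurable_apply (hA i)
  rw [hsum (fun y => 1 - expNeg y) (by simp)]
  simp only [hsum (fun y => (y : ℝ≥0∞)) rfl, expNeg_sum]
  have hind := (h.indep n A hA hb hd).comp (fun i x => expNeg (v i * x)) (fun i => by fun_prop)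
  have hprod := lintegral_prod_eq_prod_lintegral_of_indepFun Finset.univ _ hind
    (fun i => by have := hm i; fun_prop)
  simp only [Function.comp_apply] at hprod
  rw [hprod]
  refine Finset.prod_congr rfl fun i _ => ?_
  have hc : Measurable fun n : ℕ => (n : ℝ≥0∞) := measurable_of_countable _
  rw [← lintegral_map (f := fun x => expNeg (v i * x)) (by fun_prop) (hm i),
    h.map_eval _ (hA i) (hb i), lintegral_map (by fun_prop) hc, lintegral_expNeg_poissonMeasure,
    ENNReal.coe_toNNReal (κ.apply_lt_top (hA i) (hb i)).ne]

theorem IsPoissonProcess.eq {κ : LocallyFiniteMeasure X} {P Q : Measure (PointMeasure X)}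
    (hP : IsPoissonProcess κ P) (hQ : IsPoissonProcess κ Q) : P = Q := by
  have := hP.isProbabilityMeasure
  have := hQ.isProbabilityMeasure
  refine measure_ext_of_laplace (T := PointMeasure.toLocallyFinite)
    PointMeasure.measurable_toLocallyFinite le_rfl fun f hf => ?_
  exact (hP.lintegral_expNeg_simpleFunc f hf).trans (hQ.lintegral_expNeg_simpleFunc f hf).symm

/-- The definition gives the transform only at simple functions of bounded support. These determine
the law, so the process is the constructed one, for which the formula holds at every measurable `f`.
-/
theorem IsPoissonProcess.hasPoissonLaplace {κ : LocallyFiniteMeasure X}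
    {P : Measure (PointMeasure X)} (h : IsPoissonProcess κ P) :
    HasPoissonLaplace κ.toMeasure P PointMeasure.toMeasure := by
  obtain ⟨Q, hQ, hL⟩ := exists_hasPoissonLaplace κ
  rwa [h.eq hL.isPoissonProcess]

theorem exists_isPoissonProcess_kernel :
    ∃ Poi : Kernel (LocallyFiniteMeasure X) (PointMeasure X), ∀ κ, IsPoissonProcess κ (Poi κ) := by
  choose P hP hL using exists_hasPoissonLaplace (X := X)
  refine ⟨⟨P, ?_⟩, fun κ => HasPoissonLaplace.isPoissonProcess (hL κ)⟩
  refine measurable_measure_of_laplace (T := PointMeasure.toLocallyFinite)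
    PointMeasure.measurable_toLocallyFinite le_rfl P fun f _ => ?_
  have : ∀ κ, ∫⁻ z, expNeg (∫⁻ x, f x ∂z.toLocallyFinite.toMeasure) ∂(P κ) =
      expNeg (∫⁻ x, (1 - expNeg (f x)) ∂κ.toMeasure) := fun κ =>
    hL κ _ (SimpleFunc.measurable_coe_ennreal f)
  simp only [this]
  have hm := SimpleFunc.measurable_coe_ennreal f
  fun_prop

end PoissonProcess

/-! ### The Mecke formula. -/

section Mecke

open Filter Topology LocallyFiniteMeasure

variable {X : Type*} [MetricSpace X] [MeasurableSpace X] [BorelSpace X]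

variable (X) in
theorem exists_bounded_partition : ∃ B : ℕ → Set X, (∀ n, MeasurableSet (B n)) ∧
    (∀ n, IsBounded (B n)) ∧ Pairwise (Function.onFun Disjoint B) ∧ ⋃ n, B n = Set.univ := by
  rcases isEmpty_or_nonempty X with hX | ⟨⟨x₀⟩⟩
  · exact ⟨fun _ => ∅, by simp, by simp, fun _ _ _ => by simp [Function.onFun],
      Set.eq_univ_of_forall fun x => hX.elim x⟩
  · refine ⟨disjointed fun n : ℕ => Metric.closedBall x₀ n, fun n =>
      MeasurableSet.disjointed (fun _ => Metric.isClosed_closedBall.measurableSet) n, fun n =>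
      Metric.isBounded_closedBall.subset (disjointed_subset _ n), disjoint_disjointed _, ?_⟩
    rw [iUnion_disjointed, Metric.iUnion_closedBall_nat]

namespace LocallyFiniteMeasure

variable (X) in
/-- A locally finite measure, as a kernel. -/
noncomputable def kernel : Kernel (LocallyFiniteMeasure X) X := ⟨toMeasure, measurable_toMeasure⟩

theorem kernel_apply (κ : LocallyFiniteMeasure X) : kernel X κ = κ.toMeasure := rfl

/-- The mass `κ(B n)` is finite but not bounded uniformly in `κ`. Each bounded piece is therefore
cut again according to the integer part `k` of `κ(B n)`, which bounds the mass by `k + 1`. The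
instance makes integrals against a random measure measurable in its parameters. -/
instance : IsSFiniteKernel (kernel X) := by
  classical
  obtain ⟨B, hB, hb, hd, hU⟩ := exists_bounded_partition X
  have hs : ∀ p : ℕ × ℕ, MeasurableSet
      {κ : LocallyFiniteMeasure X | ⌊(κ.toMeasure (B p.1)).toReal⌋₊ = p.2} := fun p =>
    measurableSet_eq_fun
      (Nat.measurable_floor.comp (measurable_eval (hB p.1) (hb p.1)).ennreal_toReal)
      measurable_const
  let K : ℕ × ℕ → Kernel (LocallyFiniteMeasure X) X := fun p =>
    Kernel.piecewise (hs p) ((kernel X).restrict (hB p.1)) 0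
  have hK : ∀ p, IsFiniteKernel (K p) := fun p =>
    ⟨⟨ENNReal.ofReal (p.2 + 1), ENNReal.ofReal_lt_top, fun κ => by
      simp only [K, Kernel.piecewise_apply', Kernel.restrict_apply' _ _ _ MeasurableSet.univ,
        Set.univ_inter, kernel_apply]
      split_ifs with h
      · have h' : ⌊(κ.toMeasure (B p.1)).toReal⌋₊ = p.2 := h
        rw [← ENNReal.ofReal_toReal (κ.apply_lt_top (hB p.1) (hb p.1)).ne, ← h']
        exact ENNReal.ofReal_le_ofReal (Nat.lt_floor_add_one _).le
      · simp⟩⟩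
  have hsum : kernel X = Kernel.sum K := by
    ext κ S hS
    rw [Kernel.sum_apply' _ _ hS, ENNReal.tsum_prod', kernel_apply]
    have h1 : ∀ n, ∑' k, K (n, k) κ S = κ.toMeasure (S ∩ B n) := fun n => by
      rw [tsum_eq_single ⌊(κ.toMeasure (B n)).toReal⌋₊]
      · simp only [K, Kernel.piecewise_apply', Kernel.restrict_apply' _ _ _ hS, kernel_apply]
        exact if_pos rfl
      · intro k hk
        simp only [K, Kernel.piecewise_apply']
        exact (if_neg fun h => hk (Eq.symm h)).trans (by simp)
    simp only [h1]
    rw [← measure_iUnion (fun i j hij => (hd hij).mono Set.inter_subset_right Set.inter_subset_right)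
      (fun n => hS.inter (hB n)), ← Set.inter_iUnion, hU, Set.inter_univ]
  rw [hsum]
  infer_instance

end LocallyFiniteMeasure

namespace PointMeasure

theorem exists_natCast_eq (μ : PointMeasure X) {A : Set X} (hA : MeasurableSet A)
    (hb : IsBounded A) : ∃ n : ℕ, μ.toMeasure A = n := μ.2 A hA hb

variable (X) in
/-- A point measure, as a kernel. -/
noncomputable def kernel : Kernel (PointMeasure X) X :=
  (LocallyFiniteMeasure.kernel X).comap toLocallyFinite measurable_toLocallyFinite

instance : IsSFiniteKernel (kernel X) := by unfold kernel; infer_instance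

theorem measurable_lintegral_prod {h : X × PointMeasure X → ℝ≥0∞} (hh : Measurable h) :
    Measurable fun μ : PointMeasure X => ∫⁻ x, h (x, μ) ∂μ.toMeasure :=
  (hh.comp measurable_swap).lintegral_kernel_prod_right' (κ := kernel X)

theorem toMeasure_addDirac (μ : PointMeasure X) (x : X) :
    (μ.addDirac x).toMeasure = μ.toMeasure + Measure.dirac x := rfl

@[fun_prop]
theorem measurable_addDirac : Measurable fun p : PointMeasure X × X => p.1.addDirac p.2 := by
  refine measurable_of_toLocallyFinite (measurable_of_eval fun A hA _ => ?_)
  have : (fun p : PointMeasure X × X => ((p.1.addDirac p.2).toLocallyFinite).toMeasure A) =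
      fun p => p.1.toMeasure A + A.indicator 1 p.2 := by
    ext p
    change (p.1.addDirac p.2).toMeasure A = _
    rw [toMeasure_addDirac, Measure.add_apply, Measure.dirac_apply' _ hA]
  rw [this]
  exact ((measurable_apply hA).comp measurable_fst).add
    ((measurable_one.indicator hA).comp measurable_snd)

end PointMeasure

open PointMeasure

theorem lintegral_one_sub_expNeg_simpleFunc_ne_top (κ : LocallyFiniteMeasure X)
    (f : SimpleFunc X ℝ≥0) (hf : IsBounded (Function.support f)) :
    ∫⁻ x, (1 - expNeg (f x)) ∂κ.toMeasure ≠ ∞ := by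
  have hm : MeasurableSet (Function.support f) := measurableSet_support f.measurable
  have : ∫⁻ x, (1 - expNeg (f x)) ∂κ.toMeasure ≤ κ.toMeasure (Function.support f) := by
    rw [← lintegral_indicator_one hm]
    refine lintegral_mono fun x => ?_
    by_cases hx : f x = 0
    · simp [hx]
    · rw [Set.indicator_of_mem (by exact hx)]
      exact tsub_le_self
  exact (this.trans_lt (κ.apply_lt_top hm hf)).ne

/-- The Mecke formula for rectangles. -/
theorem HasPoissonLaplace.mecke_prod {κ : LocallyFiniteMeasure X} {P : Measure (PointMeasure X)}
    [IsProbabilityMeasure P] (h : HasPoissonLaplace κ.toMeasure P toMeasure) {A : Set X}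
    (hA : MeasurableSet A) (hb : IsBounded A) :
    P.withDensity (fun μ => μ.toMeasure A) =
      (P.prod (κ.toMeasure.restrict A)).map fun p => p.1.addDirac p.2 := by
  have hAm := measurable_apply hA
  have hfin : IsFiniteMeasure (κ.toMeasure.restrict A) :=
    ⟨by simpa using κ.apply_lt_top hA hb⟩
  have hfin' : IsFiniteMeasure (P.withDensity fun μ => μ.toMeasure A) := by
    refine isFiniteMeasure_withDensity ?_
    have := h.lintegral_mul_expNeg measurable_toMeasure hA (κ.apply_lt_top hA hb).ne
      (f := fun _ => 0) measurable_const (by simp)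
    simp only [lintegral_zero, expNeg_zero, mul_one] at this
    rw [this]
    simpa using (κ.apply_lt_top hA hb).ne
  refine measure_ext_of_laplace (T := toLocallyFinite) measurable_toLocallyFinite le_rfl
    fun f hf => ?_
  have hfm := SimpleFunc.measurable_coe_ennreal f
  change ∫⁻ μ : PointMeasure X, expNeg (∫⁻ x, f x ∂μ.toMeasure) ∂_ =
    ∫⁻ μ : PointMeasure X, expNeg (∫⁻ x, f x ∂μ.toMeasure) ∂_
  rw [lintegral_withDensity_eq_lintegral_mul _ hAm (by fun_prop),
    lintegral_map (by fun_prop) measurable_addDirac]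
  -- On the other side an added point at `x` contributes the factor `e^{-f(x)}`, integrated over
  -- `A`; this is the same transform.
  have h1 := h.lintegral_mul_expNeg measurable_toMeasure hA (κ.apply_lt_top hA hb).ne hfm
    (lintegral_one_sub_expNeg_simpleFunc_ne_top κ f hf)
  refine h1.trans ?_
  simp only [toMeasure_addDirac, lintegral_add_measure, lintegral_dirac' _ hfm, expNeg_add]
  rw [lintegral_prod_mul (f := fun μ : PointMeasure X => expNeg (∫⁻ x, f x ∂μ.toMeasure))
    (g := fun x => expNeg (f x)) (by fun_prop) (by fun_prop), h _ hfm, mul_comm]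

/-- The Mecke formula for the Poisson process. -/
theorem HasPoissonLaplace.mecke {κ : LocallyFiniteMeasure X} {P : Measure (PointMeasure X)}
    [IsProbabilityMeasure P] (h : HasPoissonLaplace κ.toMeasure P toMeasure)
    {g : X × PointMeasure X → ℝ≥0∞} (hg : Measurable g) :
    ∫⁻ μ, ∫⁻ x, g (x, μ) ∂μ.toMeasure ∂P =
      ∫⁻ μ, ∫⁻ x, g (x, μ.addDirac x) ∂κ.toMeasure ∂P := by
  have hφ : Measurable fun p : PointMeasure X × X => (p.1.addDirac p.2, p.2) :=
    measurable_addDirac.prodMk measurable_snd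
  -- An identity of measures on pairs `(μ, x)`. Over a bounded piece `B n` both sides are finite, so
  -- agreement on rectangles, which is `mecke_prod`, suffices.
  have key : P ⊗ₘ (kernel X) =
      (P.prod κ.toMeasure).map fun p : PointMeasure X × X => (p.1.addDirac p.2, p.2) := by
    obtain ⟨B, hB, hb, -, hU⟩ := exists_bounded_partition X
    refine Measure.ext_of_iUnion_eq_univ (s := fun n => Set.univ ×ˢ B n) ?_ fun n => ?_
    · rw [← Set.prod_iUnion, hU, Set.univ_prod_univ]
    have hrect : ∀ (S : Set (PointMeasure X)) (A : Set X), MeasurableSet S → MeasurableSet A →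
        IsBounded A → (P ⊗ₘ (kernel X)) (S ×ˢ A) = ((P.prod κ.toMeasure).map
          fun p : PointMeasure X × X => (p.1.addDirac p.2, p.2)) (S ×ˢ A) := by
      intro S A hS hA hAb
      have h1 := congrArg (fun M : Measure (PointMeasure X) => M S) (h.mecke_prod hA hAb)
      simp only [withDensity_apply _ hS, Measure.map_apply measurable_addDirac hS] at h1
      rw [Measure.compProd_apply_prod hS hA, Measure.map_apply hφ (hS.prod hA)]
      refine h1.trans ?_
      have h2 : P.prod (κ.toMeasure.restrict A) =
          (P.prod κ.toMeasure).restrict (Set.univ ×ˢ A) := by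
        rw [← Measure.prod_restrict, Measure.restrict_univ]
      rw [h2, Measure.restrict_apply (measurable_addDirac hS)]
      congr 1
      ext p; simp
    have hfin : IsFiniteMeasure ((P ⊗ₘ (kernel X)).restrict (Set.univ ×ˢ B n)) := by
      refine ⟨?_⟩
      rw [Measure.restrict_apply_univ, hrect _ _ MeasurableSet.univ (hB n) (hb n),
        Measure.map_apply hφ (MeasurableSet.univ.prod (hB n))]
      have : (fun p : PointMeasure X × X => (p.1.addDirac p.2, p.2)) ⁻¹' (Set.univ ×ˢ B n) =
          Set.univ ×ˢ B n := by ext p; simp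
      rw [this, Measure.prod_prod]
      simpa using κ.apply_lt_top (hB n) (hb n)
    refine Measure.ext_prod fun {S A} hS hA => ?_
    rw [Measure.restrict_apply (hS.prod hA), Measure.restrict_apply (hS.prod hA), Set.prod_inter_prod,
      Set.inter_univ]
    exact hrect _ _ hS (hA.inter (hB n)) ((hb n).subset Set.inter_subset_right)
  have h1 := congrArg (fun M : Measure (PointMeasure X × X) => ∫⁻ p, g (p.2, p.1) ∂M) key
  have hgs : Measurable fun p : PointMeasure X × X => g (p.2, p.1) := hg.comp measurable_swap
  simp only [Measure.lintegral_compProd hgs, lintegral_map hgs hφ] at h1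
  refine h1.trans (lintegral_prod _ ?_)
  exact (hgs.comp hφ).aemeasurable

end Mecke

/-! ### The Poisson-Gamma random measure. -/

section PoissonGamma

open Filter Topology LocallyFiniteMeasure

theorem lintegral_Ioi_exp_neg_mul {a : ℝ} (ha : 0 < a) :
    ∫⁻ r in Set.Ioi (0 : ℝ), ENNReal.ofReal (Real.exp (-a * r)) = ENNReal.ofReal (1 / a) := by
  rw [← ofReal_integral_eq_lintegral_ofReal (integrableOn_exp_mul_Ioi (by linarith) 0)
    (ae_of_all _ fun _ => (Real.exp_pos _).le), integral_exp_mul_Ioi (by linarith)]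
  simp

theorem lintegral_Ioc_exp_neg_mul {r s : ℝ} (hr : 0 < r) (hs : 0 ≤ s) :
    ∫⁻ u in Set.Ioc 0 s, ENNReal.ofReal (Real.exp (-(r * u))) =
      ENNReal.ofReal (r⁻¹ * (1 - Real.exp (-(r * s)))) := by
  have hc : Continuous fun u : ℝ => Real.exp (-(r * u)) := by fun_prop
  rw [← ofReal_integral_eq_lintegral_ofReal (hc.integrableOn_Ioc)
    (ae_of_all _ fun _ => (Real.exp_pos _).le), ← intervalIntegral.integral_of_le hs]
  have hd : ∀ u ∈ Set.uIcc 0 s,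
      HasDerivAt (fun u => -r⁻¹ * Real.exp (-(r * u))) (Real.exp (-(r * u))) u := fun u _ => by
    have h1 : HasDerivAt (fun u => -(r * u)) (-r) u := by
      exact ((hasDerivAt_id u).const_mul r).neg.congr_deriv (by simp)
    refine (h1.exp.const_mul (-r⁻¹)).congr_deriv ?_
    field_simp
  rw [intervalIntegral.integral_eq_sub_of_hasDerivAt hd (hc.intervalIntegrable _ _)]
  congr 1
  simp; ring

theorem lintegral_Ioc_one_div_add {c s : ℝ} (hc : 0 < c) (hs : 0 ≤ s) :
    ∫⁻ u in Set.Ioc 0 s, ENNReal.ofReal (1 / (u + c)) =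
      ENNReal.ofReal (Real.log (1 + c⁻¹ * s)) := by
  have hcont : ContinuousOn (fun u : ℝ => 1 / (u + c)) (Set.uIcc 0 s) := by
    refine continuousOn_const.div (by fun_prop) fun u hu => ?_
    rw [Set.uIcc_of_le hs] at hu
    linarith [hu.1]
  have hi := hcont.intervalIntegrable (μ := volume)
  rw [← ofReal_integral_eq_lintegral_ofReal ((intervalIntegrable_iff_integrableOn_Ioc_of_le hs).1 hi)
    (by
      refine (ae_restrict_iff' measurableSet_Ioc).2 (ae_of_all _ fun u hu => ?_)
      have := hu.1
      positivity), ← intervalIntegral.integral_of_le hs]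
  have hd : ∀ u ∈ Set.uIcc 0 s, HasDerivAt (fun u => Real.log (u + c)) (1 / (u + c)) u :=
    fun u hu => by
      rw [Set.uIcc_of_le hs] at hu
      exact ((hasDerivAt_id u).add_const c).log (by simp only [id]; linarith [hu.1])
  rw [intervalIntegral.integral_eq_sub_of_hasDerivAt hd hi]
  congr 1
  rw [zero_add, ← Real.log_div (by positivity) hc.ne']
  congr 1
  field_simp
  ring

/-- The Frullani integral `∫ (1 - e^{-rs}) r⁻¹ e^{-((1-w)/w) r} dr = log (1 + s w / (1 - w))`. -/
theorem lintegral_gammaLevy {w : ℝ} (hw0 : 0 < w) (hw1 : w < 1) (s : ℝ≥0) :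
    ∫⁻ r, (1 - expNeg (ENNReal.ofReal r * s)) ∂(gammaLevy w) =
      ENNReal.ofReal (Real.log (1 + w / (1 - w) * s)) := by
  have hc : 0 < (1 - w) / w := div_pos (by linarith) hw0
  have hm : Measurable fun r : ℝ => ENNReal.ofReal (r⁻¹ * Real.exp (-((1 - w) / w) * r)) := by
    fun_prop
  rw [gammaLevy, lintegral_withDensity_eq_lintegral_mul _ hm (by fun_prop)]
  -- Writing `r⁻¹ (1 - e^{-rs})` as `∫₀ˢ e^{-ru} du` removes the singularity; Tonelli then leaves
  -- the integral of `1/(u + (1-w)/w)` over `(0, s]`.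
  have h1 : ∀ r ∈ Set.Ioi (0 : ℝ),
      ((fun r : ℝ => ENNReal.ofReal (r⁻¹ * Real.exp (-((1 - w) / w) * r))) *
        fun r => 1 - expNeg (ENNReal.ofReal r * s)) r =
      ∫⁻ u in Set.Ioc (0 : ℝ) s, ENNReal.ofReal (Real.exp (-(u + (1 - w) / w) * r)) := by
    intro r hr
    have hr : 0 < r := hr
    have h2 : ∀ u : ℝ, ENNReal.ofReal (Real.exp (-(u + (1 - w) / w) * r)) =
        ENNReal.ofReal (Real.exp (-((1 - w) / w) * r)) *
          ENNReal.ofReal (Real.exp (-(r * u))) := fun u => by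
      rw [← ENNReal.ofReal_mul (Real.exp_pos _).le, ← Real.exp_add]
      congr 2; ring
    simp only [h2]
    rw [lintegral_const_mul _ (by fun_prop), lintegral_Ioc_exp_neg_mul hr s.coe_nonneg,
      ← ENNReal.ofReal_mul (Real.exp_pos _).le, Pi.mul_apply, ← ENNReal.ofReal_coe_nnreal (p := s),
      ← ENNReal.ofReal_mul hr.le, expNeg_ofReal (by positivity), ← ENNReal.ofReal_one,
      ← ENNReal.ofReal_sub _ (Real.exp_pos _).le, ← ENNReal.ofReal_mul (by positivity)]
    congr 1; ring
  rw [setLIntegral_congr_fun measurableSet_Ioi h1, lintegral_lintegral_swap (by fun_prop)]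
  have h3 : ∀ u ∈ Set.Ioc (0 : ℝ) s,
      ∫⁻ r in Set.Ioi (0 : ℝ), ENNReal.ofReal (Real.exp (-(u + (1 - w) / w) * r)) =
        ENNReal.ofReal (1 / (u + (1 - w) / w)) := fun u hu =>
    lintegral_Ioi_exp_neg_mul (by linarith [hu.1])
  rw [setLIntegral_congr_fun measurableSet_Ioc h3, lintegral_Ioc_one_div_add hc s.coe_nonneg,
    inv_div]

variable {X : Type*} [MetricSpace X] [MeasurableSpace X] [BorelSpace X]

/-- `s ↦ log (1 + c s)`, the exponent of the Laplace transform of a gamma distribution. -/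
noncomputable def gammaExponent (c : ℝ) (s : ℝ≥0) : ℝ≥0∞ := ENNReal.ofReal (Real.log (1 + c * s))

@[fun_prop]
theorem measurable_gammaExponent (c : ℝ) : Measurable (gammaExponent c) := by
  unfold gammaExponent; fun_prop

theorem lintegral_gammaLevy_prod {w : ℝ} (hw0 : 0 < w) (hw1 : w < 1) (σ : LocallyFiniteMeasure X)
    {f : X → ℝ≥0} (hf : Measurable f) :
    ∫⁻ p, (1 - expNeg (ENNReal.ofReal p.2 * f p.1)) ∂(σ.toMeasure.prod (gammaLevy w)) =
      ∫⁻ x, gammaExponent (w / (1 - w)) (f x) ∂σ.toMeasure := by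
  have : SFinite (gammaLevy w) := by unfold gammaLevy; infer_instance
  rw [lintegral_prod _ (by fun_prop)]
  exact lintegral_congr fun x => lintegral_gammaLevy hw0 hw1 (f x)

/-- The Lévy measure enters only through its exponent, which Tonelli and the Frullani integral turn
into `σ(log (1 + c f))` with `c = w/(1-w)`. This is the working form of the definition. -/
theorem isPoissonGamma_iff {w : ℝ} (hw0 : 0 < w) (hw1 : w < 1) (σ : LocallyFiniteMeasure X)
    (G : Measure (LocallyFiniteMeasure X)) :
    IsPoissonGamma w σ G ↔ IsProbabilityMeasure G ∧
      ∀ f : X → ℝ≥0, Measurable f → (∃ C : ℝ≥0, ∀ x, f x ≤ C) →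
        ∫⁻ κ, expNeg (∫⁻ x, f x ∂κ.toMeasure) ∂G =
          expNeg (∫⁻ x, gammaExponent (w / (1 - w)) (f x) ∂σ.toMeasure) := by
  have key : ∀ f : X → ℝ≥0, Measurable f →
      ∫⁻ ν, (1 - expNeg (∫⁻ x, f x ∂ν.toMeasure))
        ∂((σ.toMeasure.prod (gammaLevy w)).map scaledDirac) =
      ∫⁻ x, gammaExponent (w / (1 - w)) (f x) ∂σ.toMeasure := fun f hf => by
    have hf' : Measurable fun x => (f x : ℝ≥0∞) := hf.coe_nnreal_ennreal
    rw [lintegral_map (by fun_prop) measurable_scaledDirac, ← lintegral_gammaLevy_prod hw0 hw1 σ hf]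
    refine lintegral_congr fun p => ?_
    change 1 - expNeg (∫⁻ x, f x ∂(ENNReal.ofReal p.2 • Measure.dirac p.1)) = _
    rw [lintegral_smul_measure, lintegral_dirac' _ hf', smul_eq_mul]
  constructor
  · rintro ⟨h1, h2⟩
    exact ⟨h1, fun f hf hC => (h2 f hf hC).trans (congrArg expNeg (key f hf))⟩
  · rintro ⟨h1, h2⟩
    exact ⟨h1, fun f hf hC => (h2 f hf hC).trans (congrArg expNeg (key f hf).symm)⟩

theorem SimpleFunc.exists_forall_le_nnreal (f : SimpleFunc X ℝ≥0) : ∃ C : ℝ≥0, ∀ x, f x ≤ C :=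
  ⟨f.range.sup id, fun x => Finset.le_sup (f := id) (f.mem_range_self x)⟩

theorem IsPoissonGamma.eq {w : ℝ} (hw0 : 0 < w) (hw1 : w < 1) {σ : LocallyFiniteMeasure X}
    {G G' : Measure (LocallyFiniteMeasure X)} (hG : IsPoissonGamma w σ G)
    (hG' : IsPoissonGamma w σ G') : G = G' := by
  obtain ⟨h1, h2⟩ := (isPoissonGamma_iff hw0 hw1 σ G).1 hG
  obtain ⟨h1', h2'⟩ := (isPoissonGamma_iff hw0 hw1 σ G').1 hG'
  refine measure_ext_of_laplace (T := id) measurable_id (by simp) fun f _ => ?_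
  exact (h2 f f.measurable (SimpleFunc.exists_forall_le_nnreal f)).trans
    (h2' f f.measurable (SimpleFunc.exists_forall_le_nnreal f)).symm

/-- The mean of a random measure whose Laplace transform is that of a gamma process. -/
theorem lintegral_apply_of_gammaLaplace {Ω : Type*} [MeasurableSpace Ω] {P : Measure Ω}
    [IsFiniteMeasure P] {N : Ω → Measure X} (hN : Measurable N) {c : ℝ} (hc : 0 < c)
    {σ : LocallyFiniteMeasure X}
    (h : ∀ f : X → ℝ≥0, Measurable f → (∃ C : ℝ≥0, ∀ x, f x ≤ C) →
      ∫⁻ ω, expNeg (∫⁻ x, f x ∂(N ω)) ∂P = expNeg (∫⁻ x, gammaExponent c (f x) ∂σ.toMeasure))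
    {A : Set X} (hA : MeasurableSet A) (hb : IsBounded A) :
    ∫⁻ ω, N ω A ∂P = ENNReal.ofReal c * σ.toMeasure A := by
  have hAσ := (σ.apply_lt_top hA hb).ne
  set m := (σ.toMeasure A).toReal with hm
  -- The Laplace transform at `t 1_A`; the mean is `-ψ'(0) = c m`.
  let ψ : ℝ → ℝ := fun t => Real.exp (-(Real.log (1 + c * t) * m))
  have hmain : ∀ t, 0 ≤ t → ∫⁻ ω, expNeg (0 + ENNReal.ofReal t * N ω A) ∂P =
      ENNReal.ofReal (ψ t) := by
    intro t ht
    have h1 := h (A.indicator fun _ => t.toNNReal) (measurable_const.indicator hA)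
      ⟨t.toNNReal, fun x => Set.indicator_le_self' (fun _ _ => zero_le) x⟩
    have h2 : ∀ μ : Measure X, ∫⁻ x, (A.indicator (fun _ => t.toNNReal) x : ℝ≥0) ∂μ =
        ENNReal.ofReal t * μ A := fun μ => by
      have : ∀ x, ((A.indicator (fun _ => t.toNNReal) x : ℝ≥0) : ℝ≥0∞) =
          A.indicator (fun _ => ENNReal.ofReal t) x := fun x => by
        by_cases hx : x ∈ A <;> simp [hx, ENNReal.ofReal]
      simp only [this, lintegral_indicator_const hA]
    have h3 : ∫⁻ x, gammaExponent c (A.indicator (fun _ => t.toNNReal) x) ∂σ.toMeasure =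
        ENNReal.ofReal (Real.log (1 + c * t) * m) := by
      have : ∀ x, gammaExponent c (A.indicator (fun _ => t.toNNReal) x) =
          A.indicator (fun _ => ENNReal.ofReal (Real.log (1 + c * t))) x := fun x => by
        by_cases hx : x ∈ A <;> simp [hx, gammaExponent, ht]
      simp only [this, lintegral_indicator_const hA]
      rw [ENNReal.ofReal_mul (Real.log_nonneg (by nlinarith)), hm, ENNReal.ofReal_toReal hAσ]
    simp only [h2, h3] at h1
    simp only [zero_add, h1]
    rw [expNeg_ofReal]
    exact mul_nonneg (Real.log_nonneg (by nlinarith)) ENNReal.toReal_nonneg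
  have hd : HasDerivAt ψ (-(c * m)) 0 := by
    have h1 : HasDerivAt (fun t : ℝ => 1 + c * t) c 0 := by
      simpa using ((hasDerivAt_id (0 : ℝ)).const_mul c).const_add 1
    have h2 := (((h1.log (by simp)).mul_const m).neg).exp
    exact h2.congr_deriv (by simp)
  have := lintegral_mul_expNeg_of_hasDerivAt P (U := fun ω => N ω A) (V := fun _ => 0)
    ((Measure.measurable_coe hA).comp hN) measurable_const (fun t _ => (Real.exp_pos _).le) hmain hd
  simp only [expNeg_zero, mul_one] at this
  rw [this, ENNReal.ofReal_mul hc.le, hm, ENNReal.ofReal_toReal hAσ]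

theorem measure_ext_of_bounded {μ ν : Measure X}
    (h : ∀ A : Set X, MeasurableSet A → IsBounded A → μ A = ν A) : μ = ν := by
  obtain ⟨B, hB, hb, -, hU⟩ := exists_bounded_partition X
  refine Measure.ext_of_iUnion_eq_univ hU fun n => ?_
  ext A hA
  rw [Measure.restrict_apply hA, Measure.restrict_apply hA]
  exact h _ (hA.inter (hB n)) ((hb n).subset Set.inter_subset_right)

theorem IsPoissonGamma.intensityMeasure_eq {w : ℝ} (hw0 : 0 < w) (hw1 : w < 1)
    {σ : LocallyFiniteMeasure X} {G : Measure (LocallyFiniteMeasure X)}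
    (hG : IsPoissonGamma w σ G) :
    intensityMeasure G = ENNReal.ofReal (w / (1 - w)) • σ.toMeasure := by
  obtain ⟨h1, h2⟩ := (isPoissonGamma_iff hw0 hw1 σ G).1 hG
  refine measure_ext_of_bounded fun A hA hb => ?_
  rw [intensityMeasure_apply _ hA, Measure.smul_apply, smul_eq_mul]
  exact lintegral_apply_of_gammaLaplace measurable_toMeasure (div_pos hw0 (by linarith)) h2 hA hb

theorem exists_isPoissonGamma {w : ℝ} (hw0 : 0 < w) (hw1 : w < 1) (σ : LocallyFiniteMeasure X) :
    ∃ G : Measure (LocallyFiniteMeasure X), IsPoissonGamma w σ G := by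
  have : SFinite (gammaLevy w) := by unfold gammaLevy; infer_instance
  obtain ⟨Q, hQ, hL⟩ := exists_poissonRandomMeasure (σ.toMeasure.prod (gammaLevy w))
  have hr : Measurable fun p : X × ℝ => ENNReal.ofReal p.2 := by fun_prop
  -- The sum of `r δ_x` over the atoms `(x, r)` of a Poisson random measure with intensity `σ ⊗
  -- τ_w`. Although `τ_w` has infinite mass near `0`, the sum has finite mean on bounded sets and so
  -- is almost surely locally finite.
  let N : (ℕ → FiniteConfiguration (X × ℝ)) → Measure X := fun ω =>
    ((countingMeasure ω).withDensity fun p => ENNReal.ofReal p.2).map Prod.fst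
  have hNint : ∀ ω, ∀ f : X → ℝ≥0∞, Measurable f →
      ∫⁻ x, f x ∂(N ω) = ∫⁻ p, ENNReal.ofReal p.2 * f p.1 ∂(countingMeasure ω) := fun ω f hf => by
    rw [lintegral_map hf measurable_fst,
      lintegral_withDensity_eq_lintegral_mul _ hr (by fun_prop)]
    rfl
  have hN : Measurable N := by
    refine Measure.measurable_of_measurable_coe _ fun A hA => ?_
    have hi : Measurable (A.indicator (1 : X → ℝ≥0∞)) := measurable_one.indicator hA
    simp only [← lintegral_indicator_one hA, hNint _ _ hi]
    exact (Measure.measurable_lintegral (by fun_prop)).comp measurable_countingMeasure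
  have hlap : ∀ f : X → ℝ≥0, Measurable f → (∃ C : ℝ≥0, ∀ x, f x ≤ C) →
      ∫⁻ ω, expNeg (∫⁻ x, f x ∂(N ω)) ∂Q =
        expNeg (∫⁻ x, gammaExponent (w / (1 - w)) (f x) ∂σ.toMeasure) := fun f hf _ => by
    simp only [hNint _ _ hf.coe_nnreal_ennreal]
    rw [hL _ (by fun_prop), lintegral_gammaLevy_prod hw0 hw1 σ hf]
  have hae : ∀ᵐ ω ∂Q, (ofMeasure (N ω)).toMeasure = N ω := by
    refine ae_toMeasure_ofMeasure hN fun A hA hb => ?_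
    rw [lintegral_apply_of_gammaLaplace hN (div_pos hw0 (by linarith)) hlap hA hb]
    exact ENNReal.mul_ne_top ENNReal.ofReal_ne_top (σ.apply_lt_top hA hb).ne
  have hm : Measurable fun ω => ofMeasure (N ω) := measurable_ofMeasure.comp hN
  refine ⟨Q.map fun ω => ofMeasure (N ω), (isPoissonGamma_iff hw0 hw1 σ _).2
    ⟨Measure.isProbabilityMeasure_map hm.aemeasurable, fun f hf hC => ?_⟩⟩
  have hf' := hf.coe_nnreal_ennreal
  rw [lintegral_map (by fun_prop) hm, ← hlap f hf hC]
  refine lintegral_congr_ae ?_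
  filter_upwards [hae] with ω hω
  rw [hω]

theorem exists_isPoissonGamma_kernel {w : ℝ} (hw0 : 0 < w) (hw1 : w < 1) :
    ∃ K : Kernel (LocallyFiniteMeasure X) (LocallyFiniteMeasure X),
      ∀ σ, IsPoissonGamma w σ (K σ) := by
  choose G hG using exists_isPoissonGamma (X := X) hw0 hw1
  have hG' := fun σ => (isPoissonGamma_iff hw0 hw1 σ (G σ)).1 (hG σ)
  have := fun σ => (hG' σ).1
  refine ⟨⟨G, ?_⟩, hG⟩
  refine measurable_measure_of_laplace (T := id) measurable_id (by simp) G fun f _ => ?_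
  have h1 : ∀ σ, ∫⁻ κ, expNeg (∫⁻ x, f x ∂(id κ : LocallyFiniteMeasure X).toMeasure) ∂(G σ) =
      expNeg (∫⁻ x, gammaExponent (w / (1 - w)) (f x) ∂σ.toMeasure) := fun σ =>
    (hG' σ).2 f f.measurable (SimpleFunc.exists_forall_le_nnreal f)
  simp only [h1]
  have hm : Measurable fun x => gammaExponent (w / (1 - w)) (f x) :=
    (measurable_gammaExponent _).comp f.measurable
  fun_prop

end PoissonGamma

/-! ### The posterior law and the marginal law of the observation. -/

section Posterior

open Filter Topology LocallyFiniteMeasure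

variable {X : Type*} [MetricSpace X] [MeasurableSpace X] [BorelSpace X]

theorem coe_toNNReal_one_sub_expNeg (t : ℝ≥0∞) :
    ((1 - expNeg t).toNNReal : ℝ≥0∞) = 1 - expNeg t :=
  ENNReal.coe_toNNReal (tsub_le_self.trans_lt ENNReal.one_lt_top).ne

theorem toNNReal_one_sub_expNeg_le (t : ℝ≥0∞) : (1 - expNeg t).toNNReal ≤ 1 :=
  ENNReal.toNNReal_mono ENNReal.one_ne_top tsub_le_self

/-- The identity between Laplace exponents behind the posterior of the Poisson-gamma model. -/
theorem gammaExponent_add_one_sub_expNeg {z : ℝ} (hz0 : 0 < z) (hz1 : z < 1) (u g : ℝ≥0) :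
    gammaExponent (z / (1 - z)) (g + (1 - expNeg u).toNNReal) =
      gammaExponent z g +
        gammaExponent (z / (1 - z)) (1 - expNeg (u + gammaExponent z g)).toNNReal := by
  have hz : 0 < 1 - z := by linarith
  have hg : (0 : ℝ) ≤ g := g.coe_nonneg
  have hzg : 0 < 1 + z * g := by positivity
  set s := Real.exp (-u) with hs
  have hs0 : 0 < s := Real.exp_pos _
  have hs1 : s ≤ 1 := by simp [hs]
  have hu : (((1 - expNeg u).toNNReal : ℝ≥0) : ℝ) = 1 - s := by
    change (1 - expNeg u).toReal = _
    rw [expNeg_coe, ← ENNReal.ofReal_one, ← ENNReal.ofReal_sub _ hs0.le,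
      ENNReal.toReal_ofReal (by linarith)]
  have hL : 0 ≤ Real.log (1 + z * g) := Real.log_nonneg (by nlinarith)
  have hexp : expNeg (u + gammaExponent z g) = ENNReal.ofReal (s / (1 + z * g)) := by
    rw [expNeg_add, expNeg_coe, gammaExponent, expNeg_ofReal hL, ← ENNReal.ofReal_mul hs0.le,
      Real.exp_neg, Real.exp_log hzg, div_eq_mul_inv]
  have hq : s / (1 + z * g) ≤ 1 := by
    rw [div_le_one hzg]; nlinarith
  have hv : (((1 - expNeg (u + gammaExponent z g)).toNNReal : ℝ≥0) : ℝ) =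
      1 - s / (1 + z * g) := by
    change (1 - expNeg (u + gammaExponent z g)).toReal = _
    rw [hexp, ← ENNReal.ofReal_one, ← ENNReal.ofReal_sub _ (by positivity),
      ENNReal.toReal_ofReal (by linarith)]
  have hpos : 0 < 1 + z / (1 - z) * (1 - s / (1 + z * g)) := by
    have : 0 ≤ z / (1 - z) * (1 - s / (1 + z * g)) :=
      mul_nonneg (div_pos hz0 hz).le (by linarith)
    linarith
  unfold gammaExponent at hv ⊢
  rw [NNReal.coe_add, hu, hv, ← ENNReal.ofReal_add hL, ← Real.log_mul hzg.ne' hpos.ne']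
  -- With `s = e^{-u}` and `c = z/(1-z)`, what remains is `1 + c(g + 1 - s) = (1 + zg)(1 + c(1 -
  -- s/(1 + zg)))`.
  · congr 2
    field_simp
    ring
  · refine Real.log_nonneg ?_
    have : 0 ≤ z / (1 - z) * (1 - s / (1 + z * g)) :=
      mul_nonneg (div_pos hz0 hz).le (by linarith)
    linarith

variable {z : ℝ} {ρ : LocallyFiniteMeasure X}
  {Poi : Kernel (LocallyFiniteMeasure X) (PointMeasure X)} {GP : Measure (LocallyFiniteMeasure X)}

theorem isMarkovKernel_of_isPoissonProcess (hPoi : ∀ κ, IsPoissonProcess κ (Poi κ)) :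
    IsMarkovKernel Poi := ⟨fun κ => (hPoi κ).isProbabilityMeasure⟩

/-- Laplace transform of a Poisson process directed by a Poisson-gamma random measure. -/
theorem lintegral_expNeg_cox (hz0 : 0 < z) (hz1 : z < 1)
    (hPoi : ∀ κ, IsPoissonProcess κ (Poi κ)) (hGP : IsPoissonGamma z ρ GP) {F : X → ℝ≥0∞}
    (hF : Measurable F) :
    ∫⁻ μ, expNeg (∫⁻ x, F x ∂μ.toMeasure) ∂(GP.bind Poi) =
      expNeg (∫⁻ x, gammaExponent (z / (1 - z)) (1 - expNeg (F x)).toNNReal ∂ρ.toMeasure) := by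
  obtain ⟨h1, h2⟩ := (isPoissonGamma_iff hz0 hz1 ρ GP).1 hGP
  rw [Measure.lintegral_bind Poi.measurable.aemeasurable (by fun_prop)]
  rw [← h2 _ (by fun_prop) ⟨1, fun x => toNNReal_one_sub_expNeg_le (F x)⟩]
  refine lintegral_congr fun κ => ?_
  rw [(hPoi κ).hasPoissonLaplace F hF]
  simp only [coe_toNNReal_one_sub_expNeg]

/-- The joint law of parameter and observation disintegrates over the observation, with posterior
`GP_{z/(1+z), ρ+μ}`. -/
theorem joint_eq_compProd (hz0 : 0 < z) (hz1 : z < 1)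
    (hPoi : ∀ κ, IsPoissonProcess κ (Poi κ)) (hGP : IsPoissonGamma z ρ GP)
    {B : Kernel (PointMeasure X) (LocallyFiniteMeasure X)}
    (hB : ∀ μ, IsPoissonGamma (z / (1 + z)) (ρ + μ.toLocallyFinite) (B μ)) :
    (GP ⊗ₘ Poi).map Prod.swap = (GP.bind Poi) ⊗ₘ B := by
  have hw0 : 0 < z / (1 + z) := by positivity
  have hw1 : z / (1 + z) < 1 := by rw [div_lt_one (by linarith)]; linarith
  -- This makes `gammaExponent z` the exponent of the posterior, and it explains the parameter
  -- `z/(1+z)`.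
  have hw : z / (1 + z) / (1 - z / (1 + z)) = z := by
    have : 1 + z ≠ 0 := by linarith
    field_simp; ring
  have hPoiM := isMarkovKernel_of_isPoissonProcess hPoi
  obtain ⟨h1, h2⟩ := (isPoissonGamma_iff hz0 hz1 ρ GP).1 hGP
  have hB' := fun μ => (isPoissonGamma_iff hw0 hw1 _ (B μ)).1 (hB μ)
  simp only [hw] at hB'
  have hBM : IsMarkovKernel B := ⟨fun μ => (hB' μ).1⟩
  have : IsProbabilityMeasure ((GP ⊗ₘ Poi).map Prod.swap) :=
    Measure.isProbabilityMeasure_map measurable_swap.aemeasurable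
  refine measure_ext_of_laplace_pair
    (S := fun p : PointMeasure X × LocallyFiniteMeasure X => p.1.toLocallyFinite)
    (T := fun p => p.2) (PointMeasure.measurable_toLocallyFinite.comp measurable_fst)
    measurable_snd ?_ fun f g _ _ => ?_
  · refine sup_le_sup ?_ le_rfl
    exact (MeasurableSpace.comap_comp).le
  have hf := SimpleFunc.measurable_coe_ennreal f
  have hg := SimpleFunc.measurable_coe_ennreal g
  have hfPM : Measurable fun μ : PointMeasure X => ∫⁻ x, f x ∂μ.toLocallyFinite.toMeasure :=
    PointMeasure.measurable_lintegral hf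
  have hγ : Measurable fun x => gammaExponent z (g x) :=
    (measurable_gammaExponent z).comp g.measurable
  simp only [expNeg_add]
  have hm : Measurable fun p : PointMeasure X × LocallyFiniteMeasure X =>
      expNeg (∫⁻ x, f x ∂p.1.toLocallyFinite.toMeasure) * expNeg (∫⁻ x, g x ∂p.2.toMeasure) :=
    (measurable_expNeg.comp (hfPM.comp measurable_fst)).mul
      (measurable_expNeg.comp ((measurable_lintegral hg).comp measurable_snd))
  rw [lintegral_map hm measurable_swap, Measure.lintegral_compProd hm]
  refine (Measure.lintegral_compProd (hm.comp measurable_swap)).trans ?_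
  simp only [Function.comp_apply, Prod.fst_swap, Prod.snd_swap]
  -- the left-hand side
  have hleft : ∀ κ, ∫⁻ μ, expNeg (∫⁻ x, f x ∂μ.toLocallyFinite.toMeasure) *
      expNeg (∫⁻ x, g x ∂κ.toMeasure) ∂(Poi κ) =
      expNeg (∫⁻ x, ((g x + (1 - expNeg (f x)).toNNReal : ℝ≥0) : ℝ≥0∞) ∂κ.toMeasure) := fun κ => by
    rw [lintegral_mul_const _ (by fun_prop)]
    have := (hPoi κ).hasPoissonLaplace _ hf
    simp only [PointMeasure.toMeasure] at this
    rw [this, ← expNeg_add]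
    simp only [ENNReal.coe_add, coe_toNNReal_one_sub_expNeg]
    rw [lintegral_add_left hg, add_comm]
  simp only [hleft]
  obtain ⟨C, hC⟩ := SimpleFunc.exists_forall_le_nnreal g
  rw [h2 _ (by have := g.measurable; have := f.measurable; fun_prop)
    ⟨C + 1, fun x => add_le_add (hC x) (toNNReal_one_sub_expNeg_le _)⟩]
  -- the right-hand side
  have hright : ∀ μ : PointMeasure X, ∫⁻ κ, expNeg (∫⁻ x, f x ∂μ.toLocallyFinite.toMeasure) *
      expNeg (∫⁻ x, g x ∂κ.toMeasure) ∂(B μ) =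
      expNeg (∫⁻ x, gammaExponent z (g x) ∂ρ.toMeasure) *
        expNeg (∫⁻ x, (f x + gammaExponent z (g x)) ∂μ.toMeasure) := fun μ => by
    rw [lintegral_const_mul _ (by fun_prop), (hB' μ).2 g g.measurable ⟨C, hC⟩, toMeasure_add,
      lintegral_add_measure, ← expNeg_add, ← expNeg_add, lintegral_add_left hf]
    congr 1
    exact add_left_comm _ _ _
  simp only [hright]
  -- The dependence on `μ` is an exponential again, so the mixed process is evaluated at `f +
  -- γ_z(g)`; the two exponents then agree pointwise under `ρ`.
  rw [lintegral_const_mul _ (by fun_prop), lintegral_expNeg_cox hz0 hz1 hPoi hGP (by fun_prop),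
    ← expNeg_add, ← lintegral_add_left hγ]
  simp only [gammaExponent_add_one_sub_expNeg hz0 hz1]

theorem exists_posterior_kernel (hz0 : 0 < z) (ρ : LocallyFiniteMeasure X) :
    ∃ B : Kernel (PointMeasure X) (LocallyFiniteMeasure X),
      ∀ μ, IsPoissonGamma (z / (1 + z)) (ρ + μ.toLocallyFinite) (B μ) := by
  have hw1 : z / (1 + z) < 1 := by rw [div_lt_one (by linarith)]; linarith
  obtain ⟨K, hK⟩ := exists_isPoissonGamma_kernel (X := X) (w := z / (1 + z)) (by positivity) hw1
  have hm : Measurable fun μ : PointMeasure X => ρ + μ.toLocallyFinite := by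
    refine measurable_of_eval fun A hA _ => ?_
    simp only [toMeasure_add, Measure.add_apply]
    exact (PointMeasure.measurable_apply hA).const_add _
  exact ⟨K.comap _ hm, fun μ => hK _⟩

theorem IsPoissonGamma.intensityMeasure_eq_polyaSumKernel (hz0 : 0 < z) {μ : PointMeasure X}
    {G : Measure (LocallyFiniteMeasure X)}
    (hG : IsPoissonGamma (z / (1 + z)) (ρ + μ.toLocallyFinite) G) :
    intensityMeasure G = polyaSumKernel z ρ μ := by
  have hw1 : z / (1 + z) < 1 := by rw [div_lt_one (by linarith)]; linarith
  have hw : z / (1 + z) / (1 - z / (1 + z)) = z := by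
    have : 1 + z ≠ 0 := by linarith
    field_simp; ring
  rw [hG.intensityMeasure_eq (by positivity) hw1, hw]
  rfl

/-- The Poisson process directed by the Poisson-gamma random measure is a Pólya sum process. -/
theorem isPolyaSumProcess_cox (hz0 : 0 < z) (hz1 : z < 1)
    (hPoi : ∀ κ, IsPoissonProcess κ (Poi κ)) (hGP : IsPoissonGamma z ρ GP) :
    IsPolyaSumProcess z ρ (GP.bind Poi) := by
  have hPoiM := isMarkovKernel_of_isPoissonProcess hPoi
  have := hGP.isProbabilityMeasure
  obtain ⟨B, hB⟩ := exists_posterior_kernel (X := X) hz0 ρ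
  have hBM : IsMarkovKernel B := ⟨fun μ => (hB μ).isProbabilityMeasure⟩
  refine ⟨inferInstance, fun h hh => ?_⟩
  have hΦ : Measurable fun p : PointMeasure X × LocallyFiniteMeasure X =>
      ∫⁻ x, h (x, p.1.addDirac x) ∂p.2.toMeasure := by
    have h1 : Measurable fun q : (PointMeasure X × LocallyFiniteMeasure X) × X =>
        h (q.2, q.1.1.addDirac q.2) := by fun_prop
    exact h1.lintegral_kernel_prod_right'
      (κ := (LocallyFiniteMeasure.kernel X).comap (Prod.snd : PointMeasure X × _ → _)
        measurable_snd)
  -- After the Mecke formula the integrand depends on `κ` only through an integral against `κ(dx)`.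
  -- Integrating under the posterior instead replaces `κ` by its posterior mean, the Pólya sum
  -- kernel.
  have hjoint := congrArg (fun M : Measure (PointMeasure X × LocallyFiniteMeasure X) =>
    ∫⁻ p, ∫⁻ x, h (x, p.1.addDirac x) ∂p.2.toMeasure ∂M) (joint_eq_compProd hz0 hz1 hPoi hGP hB)
  simp only [lintegral_map hΦ measurable_swap, Measure.lintegral_compProd hΦ] at hjoint
  replace hjoint := (Measure.lintegral_compProd (μ := GP) (κ := Poi)
    (hΦ.comp measurable_swap)).symm.trans hjoint
  rw [Measure.lintegral_bind Poi.measurable.aemeasurable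
    (PointMeasure.measurable_lintegral_prod hh).aemeasurable]
  have hmecke : ∀ κ, ∫⁻ μ, ∫⁻ x, h (x, μ) ∂μ.toMeasure ∂(Poi κ) =
      ∫⁻ μ, ∫⁻ x, h (x, μ.addDirac x) ∂κ.toMeasure ∂(Poi κ) := fun κ =>
    (hPoi κ).hasPoissonLaplace.mecke hh
  simp only [hmecke]
  refine hjoint.trans (lintegral_congr fun μ => ?_)
  have hm : Measurable fun x => h (x, μ.addDirac x) :=
    hh.comp (measurable_id.prodMk (PointMeasure.measurable_addDirac.comp measurable_prodMk_left))
  rw [← (hB μ).intensityMeasure_eq_polyaSumKernel hz0, intensityMeasure,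
    Measure.lintegral_bind measurable_toMeasure.aemeasurable hm.aemeasurable]

end Posterior

/-! ### Uniqueness of the Pólya sum process. -/

section PolyaUniqueness

open LocallyFiniteMeasure

/-- Induction on the total `∑ n i`: a nonzero index is reached from one with total smaller by one,
and the factor `n j + 1` is nonzero and finite, hence cancels. -/
theorem eq_of_update_recursion {k : ℕ} {a b : (Fin k → ℕ) → ℝ≥0∞} {c : Fin k → ℕ → ℝ≥0∞}
    (ha : ∀ n j, ((n j + 1 : ℕ) : ℝ≥0∞) * a (Function.update n j (n j + 1)) = c j (n j) * a n)
    (hb : ∀ n j, ((n j + 1 : ℕ) : ℝ≥0∞) * b (Function.update n j (n j + 1)) = c j (n j) * b n)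
    (h0 : a 0 = b 0) : a = b := by
  suffices h : ∀ N : ℕ, ∀ n : Fin k → ℕ, ∑ i, n i = N → a n = b n from
    funext fun n => h _ n rfl
  intro N
  induction N with
  | zero =>
    intro n hn
    have : n = 0 := by
      ext i
      exact (Finset.sum_eq_zero_iff.1 hn) i (Finset.mem_univ i)
    rw [this, h0]
  | succ N ih =>
    intro n hn
    obtain ⟨j, -, hj⟩ := Finset.exists_ne_zero_of_sum_ne_zero (hn.trans_ne N.succ_ne_zero)
    obtain ⟨m, hm⟩ := Nat.exists_eq_succ_of_ne_zero hj
    set n' := Function.update n j m with hn'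
    have hn'j : n' j = m := by simp [hn']
    have hup : Function.update n' j (n' j + 1) = n := by
      rw [hn'j, hn', Function.update_idem, ← Nat.succ_eq_add_one, ← hm, Function.update_eq_self]
    have hsum : ∑ i, n' i = N := by
      have h1 : ∑ i, n' i = _ := Finset.sum_update_of_mem (Finset.mem_univ j) n m
      have h2 := Finset.sum_update_of_mem (Finset.mem_univ j) n (m + 1)
      rw [← Nat.succ_eq_add_one, ← hm, Function.update_eq_self] at h2
      omega
    have h1 := ha n' j
    have h2 := hb n' j
    rw [hup] at h1 h2
    rw [ih n' hsum, ← h2] at h1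
    exact (ENNReal.mul_right_inj (by simp) (by simp)).1 h1

variable {X : Type*} [MetricSpace X] [MeasurableSpace X] [BorelSpace X]

/-- The configurations with a prescribed number of points in each of finitely many sets. -/
def countEvent {k : ℕ} (A : Fin k → Set X) (n : Fin k → ℕ) : Set (PointMeasure X) :=
  {μ | ∀ i, μ.toMeasure (A i) = n i}

section CountEvent

variable {k : ℕ} {A : Fin k → Set X}

theorem measurableSet_countEvent (hA : ∀ i, MeasurableSet (A i)) (n : Fin k → ℕ) :
    MeasurableSet (countEvent A n) := by
  have : countEvent A n = ⋂ i, {μ : PointMeasure X | μ.toMeasure (A i) = n i} := by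
    ext μ; simp [countEvent]
  rw [this]
  exact MeasurableSet.iInter fun i =>
    measurableSet_eq_fun (PointMeasure.measurable_apply (hA i)) measurable_const

theorem disjoint_countEvent :
    Pairwise (Function.onFun Disjoint (countEvent A)) := fun n n' hnn' =>
  Set.disjoint_left.2 fun μ (h : ∀ i, _) (h' : ∀ i, _) => hnn' <| funext fun i => by
    have := (h i).symm.trans (h' i)
    exact_mod_cast this

theorem iUnion_countEvent (hA : ∀ i, MeasurableSet (A i)) (hb : ∀ i, IsBounded (A i)) :
    ⋃ n, countEvent A n = Set.univ := by
  refine Set.eq_univ_of_forall fun μ => ?_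
  choose n hn using fun i => μ.exists_natCast_eq (hA i) (hb i)
  exact Set.mem_iUnion.2 ⟨n, hn⟩

/-- The Campbell identity for `h(x, μ) = 1_{A j}(x) 1_S(μ)`. On the left each configuration in `S`
has `n j + 1` points in `A j`; on the right, by disjointness, adding a point of `A j` leads into `S`
exactly from the counts `n`. -/
theorem IsPolyaSumProcess.measure_countEvent_update {z : ℝ} {ρ : LocallyFiniteMeasure X}
    {P : Measure (PointMeasure X)} (h : IsPolyaSumProcess z ρ P) (hA : ∀ i, MeasurableSet (A i))
    (hd : ∀ i j, i ≠ j → Disjoint (A i) (A j)) (n : Fin k → ℕ) (j : Fin k) :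
    ((n j + 1 : ℕ) : ℝ≥0∞) * P (countEvent A (Function.update n j (n j + 1))) =
      ENNReal.ofReal z * (ρ.toMeasure (A j) + n j) * P (countEvent A n) := by
  set S := countEvent A (Function.update n j (n j + 1)) with hS
  have hSm : MeasurableSet S := measurableSet_countEvent hA _
  have hTm : MeasurableSet (countEvent A n) := measurableSet_countEvent hA _
  have hcam := h.campbell (fun p => (A j).indicator 1 p.1 * S.indicator 1 p.2)
    (((measurable_one.indicator (hA j)).comp measurable_fst).mul
      ((measurable_one.indicator hSm).comp measurable_snd))
  have hL : ∀ μ : PointMeasure X,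
      ∫⁻ x, (A j).indicator 1 x * S.indicator (1 : PointMeasure X → ℝ≥0∞) μ ∂μ.toMeasure =
        S.indicator (fun _ => ((n j + 1 : ℕ) : ℝ≥0∞)) μ := fun μ => by
    rw [lintegral_mul_const _ (measurable_one.indicator (hA j)), lintegral_indicator_one (hA j)]
    by_cases hμ : μ ∈ S
    · have : μ.toMeasure (A j) = ((Function.update n j (n j + 1)) j : ℕ) := hμ j
      simp only [Function.update_self] at this
      simp [hμ, this]
    · simp [hμ]
  have hmem : ∀ (μ : PointMeasure X), ∀ x ∈ A j,
      (μ.addDirac x ∈ S ↔ μ ∈ countEvent A n) := fun μ x hx => by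
    refine forall_congr' fun i => ?_
    rw [PointMeasure.toMeasure_addDirac, Measure.add_apply, Measure.dirac_apply' _ (hA i)]
    by_cases hij : i = j
    · subst hij
      simp only [Set.indicator_of_mem hx, Pi.one_apply, Function.update_self, Nat.cast_add,
        Nat.cast_one]
      exact ENNReal.add_left_inj ENNReal.one_ne_top
    · have hxi : x ∉ A i := fun hxi => Set.disjoint_left.1 (hd i j hij) hxi hx
      simp [hxi, Function.update_of_ne hij]
  have hR : ∀ μ : PointMeasure X,
      ∫⁻ x, (A j).indicator 1 x * S.indicator (1 : PointMeasure X → ℝ≥0∞) (μ.addDirac x)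
        ∂(polyaSumKernel z ρ μ) =
      (countEvent A n).indicator (fun _ => ENNReal.ofReal z * (ρ.toMeasure (A j) + n j)) μ :=
    fun μ => by
      have h1 : ∀ x, (A j).indicator 1 x * S.indicator (1 : PointMeasure X → ℝ≥0∞) (μ.addDirac x) =
          (A j).indicator 1 x * (countEvent A n).indicator (1 : PointMeasure X → ℝ≥0∞) μ := fun x => by
        by_cases hx : x ∈ A j
        · by_cases hμ : μ ∈ countEvent A n
          · simp [hx, hμ, (hmem μ x hx).2 hμ]
          · simp [hx, hμ, mt (hmem μ x hx).1 hμ]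
        · simp [hx]
      simp only [h1]
      rw [lintegral_mul_const _ (measurable_one.indicator (hA j)), lintegral_indicator_one (hA j),
        polyaSumKernel, Measure.smul_apply, Measure.add_apply, smul_eq_mul]
      by_cases hμ : μ ∈ countEvent A n
      · simp [hμ, show μ.toMeasure (A j) = n j from hμ j]
      · simp [hμ]
  simp only [hL, hR] at hcam
  rwa [lintegral_indicator_const hSm, lintegral_indicator_const hTm] at hcam

end CountEvent

theorem IsPolyaSumProcess.eq {z : ℝ} {ρ : LocallyFiniteMeasure X}
    {P Q : Measure (PointMeasure X)} (hP : IsPolyaSumProcess z ρ P)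
    (hQ : IsPolyaSumProcess z ρ Q) : P = Q := by
  have := hP.isProbabilityMeasure
  have := hQ.isProbabilityMeasure
  refine measure_ext_of_laplace (T := PointMeasure.toLocallyFinite)
    PointMeasure.measurable_toLocallyFinite le_rfl fun f hf => ?_
  obtain ⟨k, A, v, hA, hb, hd, hsum⟩ := exists_lintegral_simpleFunc_eq_sum f hf
  have hone : ∀ R : Measure (PointMeasure X), IsProbabilityMeasure R →
      ∑' n, R (countEvent A n) = 1 := fun R hR => by
    rw [← measure_iUnion disjoint_countEvent (measurableSet_countEvent hA),
      iUnion_countEvent hA hb, measure_univ]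
  have hrecP := hP.measure_countEvent_update hA hd
  have hrecQ := hQ.measure_countEvent_update hA hd
  -- Cross-multiplied so that both sequences agree at `0` without a division by void probabilities.
  -- Summing over `n` then shows that the void probabilities coincide.
  have hprop : (fun n => P (countEvent A n) * Q (countEvent A 0)) =
      fun n => Q (countEvent A n) * P (countEvent A 0) := by
    refine eq_of_update_recursion
      (c := fun j m => ENNReal.ofReal z * (ρ.toMeasure (A j) + m)) (fun n j => ?_) (fun n j => ?_)
      (mul_comm _ _)
    · rw [← mul_assoc, hrecP, mul_assoc]
    · rw [← mul_assoc, hrecQ, mul_assoc]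
  have hzero : P (countEvent A 0) = Q (countEvent A 0) := by
    have := congrArg (fun a : (Fin k → ℕ) → ℝ≥0∞ => ∑' n, a n) hprop
    simp only [ENNReal.tsum_mul_right, hone P inferInstance, hone Q inferInstance, one_mul] at this
    exact this.symm
  have heq : (fun n => P (countEvent A n)) = fun n => Q (countEvent A n) :=
    eq_of_update_recursion (c := fun j m => ENNReal.ofReal z * (ρ.toMeasure (A j) + m))
      hrecP hrecQ hzero
  -- On each count event `μ(f)` is constant, so the transform is a series in the probabilities of
  -- the counts.
  have hlap : ∀ M : Measure (PointMeasure X),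
      ∫⁻ μ : PointMeasure X, expNeg (∫⁻ x, f x ∂μ.toMeasure) ∂M =
        ∑' n : Fin k → ℕ, expNeg (∑ i, v i * n i) * M (countEvent A n) := fun M => by
    rw [← setLIntegral_univ, ← iUnion_countEvent hA hb,
      lintegral_iUnion (measurableSet_countEvent hA) disjoint_countEvent]
    refine tsum_congr fun n => ?_
    rw [← setLIntegral_const]
    refine setLIntegral_congr_fun (measurableSet_countEvent hA n) fun μ hμ => ?_
    simp only [hsum (fun y => (y : ℝ≥0∞)) rfl, show ∀ i, μ.toMeasure (A i) = n i from hμ]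
  refine (hlap P).trans (Eq.trans ?_ (hlap Q).symm)
  exact tsum_congr fun n => by rw [congrFun heq n]

end PolyaUniqueness

/-! ### Countable generation of the σ-algebra on locally finite measures. -/

section CountablyGenerated

open LocallyFiniteMeasure

variable {X : Type*} [MetricSpace X] [MeasurableSpace X] [BorelSpace X]

/-- Needed to pass from equality of joint laws to almost sure equality of kernels. The masses of `S
∩ B n`, for `S` in a countable algebra generating the Borel sets and `B` a bounded partition,
generate everything by a Dynkin argument; intersecting with `B n` keeps masses finite, so
complements become differences. -/
instance [SecondCountableTopology X] :
    MeasurableSpace.CountablyGenerated (LocallyFiniteMeasure X) := by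
  obtain ⟨B, hB, hb, hd, hU⟩ := exists_bounded_partition X
  let C : Set (Set X) := generateSetAlgebra (MeasurableSpace.countableGeneratingSet X)
  have hCc : C.Countable :=
    countable_generateSetAlgebra (MeasurableSpace.countable_countableGeneratingSet)
  have hCgen : ‹MeasurableSpace X› = MeasurableSpace.generateFrom C := by
    rw [generateFrom_generateSetAlgebra_eq, MeasurableSpace.generateFrom_countableGeneratingSet]
  have hCalg : IsSetAlgebra C := isSetAlgebra_generateSetAlgebra
  have := hCc.to_subtype
  let Ψ : LocallyFiniteMeasure X → ℕ × C → ℝ≥0∞ := fun κ p => κ.toMeasure (p.2 ∩ B p.1)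
  have hΨ : ∀ n, ∀ S ∈ C, Measurable[MeasurableSpace.comap Ψ inferInstance]
      fun κ : LocallyFiniteMeasure X => κ.toMeasure (S ∩ B n) := fun n S hS =>
    (measurable_pi_apply ((n, ⟨S, hS⟩) : ℕ × C)).comp (comap_measurable Ψ)
  have hloc : ∀ n, ∀ S, MeasurableSet S → Measurable[MeasurableSpace.comap Ψ inferInstance]
      fun κ : LocallyFiniteMeasure X => κ.toMeasure (S ∩ B n) := by
    intro n S hS
    induction S, hS using MeasurableSpace.induction_on_inter hCgen
      (fun S hS T hT _ => hCalg.inter_mem hS hT) with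
    | empty => simp only [Set.empty_inter, measure_empty]; exact measurable_const
    | basic S hS => exact hΨ n S hS
    | compl S hS ih =>
      have : (fun κ : LocallyFiniteMeasure X => κ.toMeasure (Sᶜ ∩ B n)) =
          fun κ => κ.toMeasure (Set.univ ∩ B n) - κ.toMeasure (S ∩ B n) := by
        ext κ
        rw [← measure_sdiff (Set.inter_subset_inter_left _ (Set.subset_univ S))
          (hS.inter (hB n)).nullMeasurableSet
          (κ.apply_lt_top (hS.inter (hB n)) ((hb n).subset Set.inter_subset_right)).ne]
        congr 1
        ext x; simp; tauto
      rw [this]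
      exact (hΨ n _ hCalg.univ_mem).sub ih
    | iUnion F hF hFm ih =>
      have : (fun κ : LocallyFiniteMeasure X => κ.toMeasure ((⋃ i, F i) ∩ B n)) =
          fun κ => ∑' i, κ.toMeasure (F i ∩ B n) := by
        ext κ
        rw [Set.iUnion_inter, measure_iUnion
          (fun i j hij => (hF hij).mono Set.inter_subset_left Set.inter_subset_left)
          fun i => (hFm i).inter (hB n)]
      rw [this]
      simp only [ENNReal.tsum_eq_iSup_sum]
      exact .iSup fun s => s.measurable_fun_sum fun i _ => ih i
  have heq : (LocallyFiniteMeasure.instMeasurableSpace : MeasurableSpace (LocallyFiniteMeasure X)) =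
      MeasurableSpace.comap Ψ inferInstance := by
    refine le_antisymm (iSup_le fun A => iSup_le fun hA => iSup_le fun _ => ?_) ?_
    · rw [← measurable_iff_comap_le]
      have : (fun κ : LocallyFiniteMeasure X => κ.toMeasure A) =
          fun κ => ∑' n, κ.toMeasure (A ∩ B n) := by
        ext κ
        rw [← measure_iUnion
          (fun i j hij => (hd hij).mono Set.inter_subset_right Set.inter_subset_right)
          (fun n => hA.inter (hB n)), ← Set.inter_iUnion, hU, Set.inter_univ]
      rw [this]
      simp only [ENNReal.tsum_eq_iSup_sum]
      exact .iSup fun s => s.measurable_fun_sum fun n _ => hloc n A hA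
    · rw [← measurable_iff_comap_le, measurable_pi_iff]
      rintro ⟨n, S, hS⟩
      have hSm : MeasurableSet S := by
        rw [hCgen]; exact MeasurableSpace.measurableSet_generateFrom hS
      exact measurable_eval (hSm.inter (hB n)) ((hb n).subset Set.inter_subset_right)
  rw [heq]
  exact MeasurableSpace.CountablyGenerated.comap Ψ

end CountablyGenerated

/-! ### The corollary on the Bayes estimator. -/

theorem mainTheorem2 {X : Type*} [MetricSpace X] [PolishSpace X] [MeasurableSpace X] [BorelSpace X]
    (z : ℝ) (hz0 : 0 < z) (hz1 : z < 1) (ρ : LocallyFiniteMeasure X) :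
    -- the objects in question exist and are unique
    (∃! Poi : Kernel (LocallyFiniteMeasure X) (PointMeasure X),
      ∀ κ, IsPoissonProcess κ (Poi κ)) ∧
    (∀ w : ℝ, 0 < w → w < 1 → ∀ σ : LocallyFiniteMeasure X,
      ∃! G : Measure (LocallyFiniteMeasure X), IsPoissonGamma w σ G) ∧
    (∃! P : Measure (PointMeasure X), IsPolyaSumProcess z ρ P) ∧
    -- the intensity measure of `GP_{z/(1+z), ρ+μ}` is `z(ρ+μ)`, for every `μ`
    (∀ (μ : PointMeasure X) (G : Measure (LocallyFiniteMeasure X)),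
      IsPoissonGamma (z / (1 + z)) (ρ + μ.toLocallyFinite) G →
        intensityMeasure G = polyaSumKernel z ρ μ) ∧
    -- the Bayes estimator for the Poisson-Gamma prior
    ∀ (Poi : Kernel (LocallyFiniteMeasure X) (PointMeasure X))
      (GP : Measure (LocallyFiniteMeasure X)) (Poy : Measure (PointMeasure X)),
      (∀ κ, IsPoissonProcess κ (Poi κ)) → IsPoissonGamma z ρ GP → IsPolyaSumProcess z ρ Poy →
        (∃ B : Kernel (PointMeasure X) (LocallyFiniteMeasure X), IsBayesKernel Poi GP Poy B) ∧
        ∀ B : Kernel (PointMeasure X) (LocallyFiniteMeasure X), IsBayesKernel Poi GP Poy B →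
          ∀ᵐ μ ∂Poy,
            IsPoissonGamma (z / (1 + z)) (ρ + μ.toLocallyFinite) (B μ) ∧
            bayesEstimator B μ = polyaSumKernel z ρ μ := by
  refine ⟨?_, fun w hw0 hw1 σ => ?_, ?_,
    fun μ G hG => hG.intensityMeasure_eq_polyaSumKernel hz0, ?_⟩
  · obtain ⟨Poi, hPoi⟩ := exists_isPoissonProcess_kernel (X := X)
    exact ⟨Poi, hPoi, fun Poi' hPoi' => Kernel.ext fun κ => (hPoi' κ).eq (hPoi κ)⟩
  · obtain ⟨G, hG⟩ := exists_isPoissonGamma hw0 hw1 σ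
    exact ⟨G, hG, fun G' hG' => hG'.eq hw0 hw1 hG⟩
  · obtain ⟨Poi, hPoi⟩ := exists_isPoissonProcess_kernel (X := X)
    obtain ⟨GP, hGP⟩ := exists_isPoissonGamma hz0 hz1 ρ
    have h := isPolyaSumProcess_cox hz0 hz1 hPoi hGP
    exact ⟨_, h, fun P hP => hP.eq h⟩
  · intro Poi GP Poy hPoi hGP hPoy
    have hPoiM := isMarkovKernel_of_isPoissonProcess hPoi
    have := hGP.isProbabilityMeasure
    -- By uniqueness, the given Pólya sum process is the marginal law of the observation.
    obtain rfl := hPoy.eq (isPolyaSumProcess_cox hz0 hz1 hPoi hGP)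
    obtain ⟨B₀, hB₀⟩ := exists_posterior_kernel (X := X) hz0 ρ
    have hB₀M : IsMarkovKernel B₀ := ⟨fun μ => (hB₀ μ).isProbabilityMeasure⟩
    have hjoint := joint_eq_compProd hz0 hz1 hPoi hGP hB₀
    have hmodel : ∀ f : PointMeasure X × LocallyFiniteMeasure X → ℝ≥0∞, Measurable f →
        ∫⁻ κ, ∫⁻ μ, f (μ, κ) ∂(Poi κ) ∂GP = ∫⁻ p, f p ∂((GP ⊗ₘ Poi).map Prod.swap) := fun f hf => by
      rw [lintegral_map hf measurable_swap]
      exact (Measure.lintegral_compProd (hf.comp measurable_swap)).symm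
    refine ⟨⟨B₀, hB₀M, fun f hf => ?_⟩, fun B hB => ?_⟩
    · rw [hmodel f hf, hjoint, Measure.lintegral_compProd hf]
    · have hBM := hB.isMarkovKernel
      -- Every Bayes kernel reproduces the same joint law, tested on indicators; countable
      -- generation then gives a single null set outside which the kernels agree.
      have hBeq : (GP.bind Poi) ⊗ₘ B = (GP.bind Poi) ⊗ₘ B₀ := by
        rw [← hjoint]
        ext S hS
        have hS1 : Measurable (S.indicator (1 : PointMeasure X × LocallyFiniteMeasure X → ℝ≥0∞)) := measurable_one.indicator hS
        rw [← lintegral_indicator_one hS, ← lintegral_indicator_one hS, ← hmodel _ hS1,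
          hB.disintegration _ hS1, Measure.lintegral_compProd hS1]
      filter_upwards [Kernel.ae_eq_of_compProd_eq hBeq] with μ hμ
      have h : IsPoissonGamma (z / (1 + z)) (ρ + μ.toLocallyFinite) (B μ) := hμ ▸ hB₀ μ
      exact ⟨h, h.intensityMeasure_eq_polyaSumKernel hz0⟩
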